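/- Let $X$ be a set, $Y=\{\pm1\}$, and let $H\subseteq Y^X$ be a hypothesis class. The Littlestone dimension of $H$ is the largest $d$ (or $\infty$ if there is no largest one) for which there is a complete binary tree of depth $d$, with internal nodes labelled by elements of $X$, that is shattered by $H$: for each root-to-leaf path, read as a sequence of examples $(x_1,y_1),\dots,(x_d,y_d)$, where $x_i$ is the label of the $i$-th node and $y_i=+1$ if the path goes right there and $y_i=-1$ if it goes left, there is $h\in H$ with $h(x_i)=y_i$ for all $i$ (it is taken to be $0$ if $H=\emptyset$). A (randomized) learning algorithm with sample complexity $m$ maps each sample $S\in(X\times Y)^m$ to a probability distribution $A(S)$ on $Y^X$. It is an $(\alpha,\beta)$-accurate learner for $H$ if $\Pr_{S\sim D^m,\,h\sim A(S)}[L_D(h)>\alpha]\le\beta$ for every distribution $D$ on $X\times Y$ that is realizable by $H$, where $L_D(h)=\Pr_{(x,y)\sim D}[h(x)\ne y]$, and $D$ is realizable by $H$ if $L_D(h)=0$ for some $h\in H$. It is $(\epsilon,\delta)$-differentially private if for all samples $S,S'$ that disagree on a single example and every event $E$, $\Pr[A(S)\in E]\le e^{\epsilon}\Pr[A(S')\in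 E]+\delta$ and $\Pr[A(S')\in E]\le e^{\epsilon}\Pr[A(S)\in E]+\delta$. Here distributions $D$ on $X\times Y$ are discrete, and the distributions $A(S)$ are arbitrary probability measures on the product $\sigma$-algebra of $Y^X$. The class $H$ is privately learnable if there are functions $\epsilon(m)=o(1)$ and $\delta(m)=m^{-\omega(1)}$ and an algorithm $A$, accepting samples of every size, that is $(\epsilon(m),\delta(m))$-differentially private on samples of size $m$ for every $m$, and such that for all $\alpha,\beta>0$ there is $m_0$ such that for all $m\ge m_0$, $A$ on samples of size $m$ is an $(\alpha,\beta)$-accurate learner for $H$. Finally, $\log$ is the logarithm to base $2$, and $\log^*x=0$ if $x\le1$, $\log^*x=1+\log^*(\log x)$ if $x>1$, $\log^*\infty=\infty$. **Theorem.** There are universal constants $c,C>0$ such that the following holds. Let $H$ be a hypothesis class over a set $X$ with Littlestone dimension $d\in\mathbb N\cup\{\infty\}$, and let $A$ be a $(\frac1{16},\frac1{16})$-accurate learner for $H$ with sample complexity $m$ that is $(0.1,\delta)$-differentially private, where $\delta\le\frac{c}{m^2\log m}$ (no condition on $\delta$ if $m\le1$). Then $$m\ \ge\ C\cdot\log^*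 d .$$ In particular, every privately learnable class $H$ has finite Littlestone dimension. -/

import Mathlib

universe u

namespace PrivateLearning

open scoped ENNReal

/-! ### The iterated logarithm -/

/-- `log* x`: it is `0` for `x ≤ 1`, and `1 + log* (log₂ x)` for `x > 1`. -/
noncomputable def logStar (x : ℝ) : ℕ :=
  if x ≤ 1 then 0 else 1 + logStar (Real.logb 2 x)
termination_by ⌈x⌉₊
decreasing_by
  rename_i h
  have hx : 1 < x := not_le.mp h
  have h1 : 1 < ⌈x⌉₊ := Nat.lt_ceil.mpr (by simpa using hx)
  obtain ⟨k, hk⟩ : ∃ k, ⌈x⌉₊ = k + 1 := ⟨⌈x⌉₊ - 1, by omega⟩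
  rw [hk, Nat.lt_succ_iff, Nat.ceil_le]
  have hxk : x ≤ (k : ℝ) + 1 := by
    have := Nat.le_ceil x
    rw [hk] at this
    exact_mod_cast this
  have hpow : (k : ℝ) + 1 ≤ 2 ^ k := by
    have : k + 1 ≤ 2 ^ k := Nat.lt_two_pow_self
    exact_mod_cast this
  rw [Real.logb_le_iff_le_rpow (by norm_num) (by linarith), Real.rpow_natCast]
  exact hxk.trans hpow

/-- `log* d` for `d ∈ ℕ ∪ {∞}`, with `log* ∞ = ∞`. -/
noncomputable def logStarENat : ℕ∞ → ℕ∞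
  | ⊤ => ⊤
  | (d : ℕ) => (logStar (d : ℝ) : ℕ)

/-! ### Littlestone dimension

An hypothesis over `X` is a function `X → Bool`; the label `+1` is `true` and `-1` is `false`. -/

/-- Complete binary mistake trees of depth `d`: the internal nodes are labelled by elements of `X`.
The arguments of `node` are its label, its left subtree and its right subtree. -/
inductive MistakeTree (X : Type u) : ℕ → Type u
  | leaf : MistakeTree X 0
  | node {d : ℕ} (x : X) (left right : MistakeTree X d) : MistakeTree X (d + 1)

/-- The root-to-leaf paths of a mistake tree, as sequences of examples: going to the right child of
a node labelled `x` gives the example `(x, +1)`, going to the left child the example `(x, -1)`. -/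
def MistakeTree.paths {X : Type u} : {d : ℕ} → MistakeTree X d → Set (List (X × Bool))
  | _, .leaf => {[]}
  | _, .node x left right =>
      (fun p => (x, false) :: p) '' left.paths ∪ (fun p => (x, true) :: p) '' right.paths

/-- `T` is shattered by `H`: each root-to-leaf path is consistent with some `h ∈ H`. -/
def MistakeTree.Shattered {X : Type u} {d : ℕ} (T : MistakeTree X d) (H : Set (X → Bool)) : Prop :=
  ∀ p ∈ T.paths, ∃ h ∈ H, ∀ e ∈ p, h e.1 = e.2

/-- The Littlestone dimension: the largest depth of a complete tree shattered by `H`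
(`⊤` if there is no largest one). -/
noncomputable def littlestoneDim {X : Type u} (H : Set (X → Bool)) : ℕ∞ :=
  ⨆ (d : ℕ) (_ : ∃ T : MistakeTree X d, T.Shattered H), (d : ℕ∞)

/-! ### PAC learning -/

/-- A randomized learning algorithm with input samples of size `m`: it maps a sample `S` to a
probability distribution `A S` over hypotheses. Events are the sets of the product `σ`-algebra of
`X → Bool`, that is, the one generated by the sets `{h | h x = true}`, `x ∈ X`. -/
abbrev LearningAlgorithm (X : Type u) (m : ℕ) : Type u :=
  (Fin m → X × Bool) → MeasureTheory.ProbabilityMeasure (X → Bool)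

/-- The loss `L_D(h) = Pr_{(x,y) ∼ D} [h(x) ≠ y]`. -/
noncomputable def loss {X : Type u} (D : PMF (X × Bool)) (h : X → Bool) : ℝ≥0∞ :=
  D.toOuterMeasure {e | h e.1 ≠ e.2}

/-- `D` is realizable by `H`. -/
def Realizable {X : Type u} (H : Set (X → Bool)) (D : PMF (X × Bool)) : Prop :=
  ∃ h ∈ H, loss D h = 0

theorem tsum_prod_pmf {α : Type u} (D : PMF α) (m : ℕ) :
    ∑' S : Fin m → α, ∏ i, D (S i) = 1 := by
  induction m with
  | zero => simp
  | succ m ih =>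
    rw [← (Fin.consEquiv (fun _ : Fin (m + 1) => α)).tsum_eq, ENNReal.tsum_prod']
    simp only [Fin.consEquiv_apply, Fin.prod_univ_succ, Fin.cons_zero, Fin.cons_succ,
      ENNReal.tsum_mul_left, ih, mul_one, D.tsum_coe]

/-- The distribution `D^m` of `m` independent samples from `D`. -/
noncomputable def iid {α : Type u} (D : PMF α) (m : ℕ) : PMF (Fin m → α) :=
  ⟨fun S => ∏ i, D (S i), by
    have h := tsum_prod_pmf D m
    exact h ▸ ENNReal.summable.hasSum⟩

/-- `A` is an `(α, β)`-accurate learner for `H` (with sample complexity `m`): for each realizable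
`D`, `Pr_{S ∼ D^m, h ∼ A(S)} [L_D(h) > α] ≤ β`. -/
def IsAccurate {X : Type u} {m : ℕ} (H : Set (X → Bool)) (α β : ℝ≥0∞)
    (A : LearningAlgorithm X m) : Prop :=
  ∀ D : PMF (X × Bool), Realizable H D →
    ∑' S : Fin m → X × Bool,
      iid D m S * (A S : MeasureTheory.Measure (X → Bool)) {h | α < loss D h} ≤ β

/-! ### Differential privacy -/

/-- `p` and `q` are `(ε, δ)`-indistinguishable. -/
def Indistinguishable {Ω : Type u} [MeasurableSpace Ω] (ε δ : ℝ)
    (p q : MeasureTheory.ProbabilityMeasure Ω) : Prop :=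
  ∀ E : Set Ω, MeasurableSet E →
    (p E : ℝ) ≤ Real.exp ε * (q E : ℝ) + δ ∧ (q E : ℝ) ≤ Real.exp ε * (p E : ℝ) + δ

/-- `A` is `(ε, δ)`-differentially private: the output distributions at two samples that disagree
on a single example are `(ε, δ)`-indistinguishable. -/
def IsDifferentiallyPrivate {X : Type u} {m : ℕ} (ε δ : ℝ) (A : LearningAlgorithm X m) : Prop :=
  ∀ S S' : Fin m → X × Bool, (∃! i, S i ≠ S' i) → Indistinguishable ε δ (A S) (A S')

/-- `H` is privately learnable: it is PAC learnable by an algorithm that is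
`(ε(m), δ(m))`-differentially private with `ε(m) = o(1)` and `δ(m) = m^{-ω(1)}`,
where `m` is the size of the input sample. -/
def PrivatelyLearnable {X : Type u} (H : Set (X → Bool)) : Prop :=
  ∃ (A : (m : ℕ) → LearningAlgorithm X m) (ε δ : ℕ → ℝ),
    Filter.Tendsto ε Filter.atTop (nhds 0) ∧
    Asymptotics.SuperpolynomialDecay Filter.atTop (fun m : ℕ => (m : ℝ)) δ ∧
    (∀ m, IsDifferentiallyPrivate (ε m) (δ m) (A m)) ∧
    ∀ α β : ℝ≥0∞, 0 < α → 0 < β → ∃ m₀ : ℕ, ∀ m ≥ m₀, IsAccurate H α β (A m)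

end PrivateLearning

open PrivateLearning
open scoped ENNReal NNReal

/-!
The bound `m ≥ C · log* d` comes from a clash between accuracy, which forces the predictions of a
learner to change somewhere, and privacy, which forbids that the place of the change can be read
off. The argument needs a long sequence of thresholds in `H` on which the learner behaves uniformly.

*Thresholds.* Ramsey's theorem for trees turns a shattered tree of depth `2 ^ n - 1` into `n` points
and `n` hypotheses of `H` that restrict to thresholds on these points, up to the unspecified values
on the diagonal (`ShattersIn.exists_list`).

*Homogeneous sets.* For a sorted sample from these points and a test point outside it, the
probability that the learner labels the test point `true`, rounded to a multiple of `1 / (8 m)`,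
is a colouring of the `(m + 1)`-sets, once all arrangements of the sample, all threshold labellings
and all ranks of the test point are put into one colour. Ramsey's theorem gives a subset on which
the prediction depends on this combinatorial type only (`IsThresholds.exists_isHomogeneous`). It is
enough to start from a number of points that is a tower of exponentials of height `O(m)`: a step
from `k`-sets to `(k + 1)`-sets costs two exponentials (`ramseyBound_le`).

*Accuracy forces a jump.* Draw the sample from the uniform distribution on many points labelled by a
threshold. With high probability it has no repetition and misses most of the points. If the prediction
increased by less than `1 / (2 m)` whenever the test point passes one sample point, the error
probabilities at a negative and at a positive test point would always sum to at least `3 / 8`, which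
contradicts the accuracy (`exists_jump`).

*Privacy forbids a jump.* Move the sample point at which the jump occurs through `2 ^ K` positions
and keep the rest of the sample far away. These samples differ in one example, so the output
distributions are pairwise indistinguishable; but the predictions at test points in between tell on
which side of the test point the moving point lies, with an advantage of order `1 / m`. Binary
search in `K`, of order `m ^ 2 * log m`, independent outputs finds the position with constant
probability. By composition the `2 ^ K` disjoint events "the search returns `j`" all have
probability at least `exp (-K / 10) / 2` under one and the same distribution, which is impossible
(`no_large_threshold_family`). The hypothesis on `δ` makes the additive loss `K δ` of the composition
small.

For `m ≤ 1` nothing is assumed on `δ`; there a direct argument shows that accuracy alone excludes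
Littlestone dimension two (`IsAccurate.two_lt`).
-/

namespace PrivateLearning

/-! ### The iterated logarithm -/

theorem logStar_of_le_one {x : ℝ} (hx : x ≤ 1) : logStar x = 0 := by
  rw [logStar, if_pos hx]

theorem logStar_of_one_lt {x : ℝ} (hx : 1 < x) : logStar x = 1 + logStar (Real.logb 2 x) := by
  rw [logStar, if_neg hx.not_ge]

theorem logStar_mono : Monotone logStar := by
  intro x
  induction x using logStar.induct with
  | case1 x hx => intro y _; simp [logStar_of_le_one hx]
  | case2 x hx ih =>
    intro y hxy
    have hx : 1 < x := not_le.mp hx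
    rw [logStar_of_one_lt hx, logStar_of_one_lt (hx.trans_le hxy)]
    have := ih (Real.logb_le_logb_of_le (by norm_num) (by linarith) hxy)
    omega

theorem logStar_two_pow_le (n : ℕ) : logStar ((2 : ℝ) ^ n) ≤ 1 + logStar n := by
  rcases Nat.eq_zero_or_pos n with rfl | hn
  · simp [logStar_of_le_one]
  · rw [logStar_of_one_lt (one_lt_pow₀ (by norm_num) hn.ne')]
    simp [Real.logb_pow]

theorem logStar_natCast_le (n : ℕ) : logStar n ≤ n := by
  induction n with
  | zero => simp [logStar_of_le_one]
  | succ n ih =>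
    have h : ((n + 1 : ℕ) : ℝ) ≤ 2 ^ n := by exact_mod_cast Nat.lt_two_pow_self
    have := (logStar_mono h).trans (logStar_two_pow_le n)
    omega

theorem logStar_iterate_le (k y : ℕ) :
    logStar (((fun y : ℕ => 2 ^ 2 ^ y)^[k] y : ℕ) : ℝ) ≤ 2 * k + logStar y := by
  induction k with
  | zero => simp
  | succ k ih =>
    rw [Function.iterate_succ_apply']
    set z := (fun y : ℕ => 2 ^ 2 ^ y)^[k] y
    have h1 := logStar_two_pow_le (2 ^ z)
    have h2 := logStar_two_pow_le z
    push_cast at h1 ⊢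
    omega

/-! ### Ramsey's theorem for finite subsets of `ℕ` -/

/-- Every colouring of the finite sets of naturals is end-homogeneous on some large set: the colour
of a set depends only on what is left when its maximum is removed.

The induction adds the minimum `a` to a set that is end-homogeneous for the colouring
`I ↦ (c I, c (insert a I))`. -/
theorem exists_endHomogeneous (t : ℕ) : ∀ {Q : Type} [Fintype Q] (c : Finset ℕ → Q) (q : ℕ),
    2 ≤ q → Fintype.card Q ≤ q → ∀ A : Finset ℕ, q ^ (2 ^ (t + 1) - 2) ≤ A.card →
    ∃ B ⊆ A, B.card = t ∧ ∃ c' : Finset ℕ → Q,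
      ∀ I ⊆ B, ∀ x ∈ B, (∀ i ∈ I, i < x) → c (insert x I) = c' I := by
  induction t with
  | zero =>
    intro Q _ c q _ _ A _
    exact ⟨∅, by simp, by simp, c, by simp⟩
  | succ t ih =>
    intro Q _ c q hq hQ A hA
    classical
    set F := (q ^ 2) ^ (2 ^ (t + 1) - 2) with hF
    have hFpos : 1 ≤ F := Nat.one_le_pow _ _ (by positivity)
    have hAF : q * (F + 1) ≤ A.card := by
      refine le_trans ?_ hA
      have h2 : 2 ≤ 2 ^ (t + 1) := by rw [pow_succ]; have := Nat.one_le_two_pow (n := t); omega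
      have : 2 ^ (t + 1 + 1) - 2 = 2 * (2 ^ (t + 1) - 2) + 1 + 1 := by
        rw [pow_succ 2 (t + 1)]; omega
      rw [this, pow_succ, pow_succ, pow_mul, ← hF, mul_comm]
      gcongr
      nlinarith
    -- On `A₀` the singletons have the same colour `z`.
    obtain ⟨z, -, hz⟩ : ∃ z ∈ (Finset.univ : Finset Q),
        F + 1 ≤ (A.filter fun x => c {x} = z).card := by
      refine Finset.exists_le_card_fiber_of_mul_le_card_of_maps_to (by simp) ⟨c ∅, by simp⟩ ?_
      rw [Finset.card_univ]
      exact (Nat.mul_le_mul_right _ hQ).trans hAF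
    set A₀ := A.filter fun x => c {x} = z
    have hne : A₀.Nonempty := Finset.card_pos.mp (by omega)
    set a := A₀.min' hne
    have haA₀ : a ∈ A₀ := A₀.min'_mem hne
    obtain ⟨B, hBA, hBt, d', hd'⟩ := ih (fun I => (c I, c (insert a I))) (q ^ 2)
      (by nlinarith) (by rw [Fintype.card_prod, sq]; exact Nat.mul_le_mul hQ hQ) (A₀.erase a)
      (by rw [Finset.card_erase_of_mem haA₀]; omega)
    have hB₀ : B ⊆ A₀ := hBA.trans (Finset.erase_subset _ _)
    have haB : a ∉ B := fun h => by simpa using hBA h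
    have hmin : ∀ y ∈ B, a < y := fun y hy =>
      lt_of_le_of_ne (A₀.min'_le y (hB₀ hy)) (fun h => haB (h ▸ hy))
    have hsub : insert a B ⊆ A₀ := Finset.insert_subset haA₀ hB₀
    refine ⟨insert a B, hsub.trans (Finset.filter_subset _ _), by simp [haB, hBt],
      fun I => if I = ∅ then z else if a ∈ I then (d' (I.erase a)).2 else (d' I).1, ?_⟩
    intro I hI x hx hlt
    by_cases hI0 : I = ∅
    · subst hI0
      simpa using (Finset.mem_filter.mp (hsub hx)).2
    obtain ⟨i, hi⟩ := Finset.nonempty_iff_ne_empty.mpr hI0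
    have hax : a < x := by
      refine lt_of_le_of_lt ?_ (hlt i hi)
      exact A₀.min'_le i (hsub (hI hi))
    have hxB : x ∈ B := (Finset.mem_insert.mp hx).resolve_left hax.ne'
    simp only [hI0, if_false]
    split_ifs with haI
    · have := hd' (I.erase a) (by rwa [← Finset.subset_insert_iff]) x hxB
        (fun i hi => hlt i (Finset.mem_of_mem_erase hi))
      rw [← this, Finset.insert_comm, Finset.insert_erase haI]
    · rw [← hd' I ((Finset.subset_insert_iff_of_notMem haI).mp hI) x hxB hlt]

/-- A bound for the number of points that force, for `k`-sets in `q` colours, a homogeneous set of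
`N` points. -/
def ramseyBound (q N : ℕ) : ℕ → ℕ
  | 0 => N
  | k + 1 => q ^ 2 ^ (ramseyBound q N k + 1)

/-- Ramsey's theorem for `k`-sets, by induction on `k`: the colouring of a large end-homogeneous set
induces one of its sets with one element less. -/
theorem exists_homogeneous {Q : Type} [Fintype Q] {q N : ℕ} (hq : 2 ≤ q)
    (hQ : Fintype.card Q ≤ q) (k : ℕ) : ∀ (c : Finset ℕ → Q) (A : Finset ℕ),
    ramseyBound q N k ≤ A.card →
    ∃ B ⊆ A, B.card = N ∧ ∃ z : Q, ∀ I ⊆ B, I.card = k → c I = z := by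
  induction k with
  | zero =>
    intro c A hA
    obtain ⟨B, hB, hN⟩ := Finset.exists_subset_card_eq hA
    exact ⟨B, hB, hN, c ∅, fun I _ hI => by rw [Finset.card_eq_zero.mp hI]⟩
  | succ k ih =>
    intro c A hA
    obtain ⟨B, hBA, hBt, c', hc'⟩ := exists_endHomogeneous (ramseyBound q N k) c q hq hQ A
      (le_trans (Nat.pow_le_pow_right (by omega) (Nat.sub_le _ _)) hA)
    obtain ⟨B', hB', hN, z, hz⟩ := ih c' B hBt.ge
    refine ⟨B', hB'.trans hBA, hN, z, fun I hI hIk => ?_⟩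
    have hne : I.Nonempty := Finset.card_pos.mp (by omega)
    have hmem := I.max'_mem hne
    have := hc' (I.erase (I.max' hne)) (((I.erase_subset _).trans hI).trans hB') _
      (hB' (hI hmem)) (fun i hi => I.lt_max'_of_mem_erase_max' hne hi)
    rw [Finset.insert_erase hmem] at this
    rw [this]
    exact hz _ ((I.erase_subset _).trans hI) (by rw [Finset.card_erase_of_mem hmem]; omega)

/-- The Ramsey bound is a tower of `2 k` exponentials. The summand `L + 2` absorbs the number of
colours in each step. -/
theorem ramseyBound_le {q N L : ℕ} (hq : q ≤ 2 ^ 2 ^ L) (k : ℕ) :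
    ramseyBound q N k + (L + 2) ≤ (fun y : ℕ => 2 ^ 2 ^ y)^[k] (N + (L + 2)) := by
  induction k with
  | zero => simp [ramseyBound]
  | succ k ih =>
    rw [Function.iterate_succ_apply']
    set y := (fun y : ℕ => 2 ^ 2 ^ y)^[k] (N + (L + 2))
    refine le_trans ?_ (Nat.pow_le_pow_right (by norm_num) (Nat.pow_le_pow_right (by norm_num) ih))
    set r := ramseyBound q N k
    have h1 : q ^ 2 ^ (r + 1) ≤ 2 ^ 2 ^ (L + (r + 1)) := by
      rw [pow_add 2 L, pow_mul]
      exact Nat.pow_le_pow_left hq _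
    have h2 : L + (r + 1) + 1 ≤ 2 ^ 2 ^ (L + (r + 1)) :=
      (Nat.lt_two_pow_self (n := L + (r + 1))).trans Nat.lt_two_pow_self
    have h3 : 2 * 2 ^ 2 ^ (L + (r + 1)) ≤ 2 ^ 2 ^ (r + (L + 2)) := by
      rw [← pow_succ']
      refine Nat.pow_le_pow_right (by norm_num) ?_
      rw [show r + (L + 2) = L + (r + 1) + 1 by ring, pow_succ 2 (L + (r + 1))]
      have := Nat.one_le_two_pow (n := L + (r + 1))
      omega
    change q ^ 2 ^ (r + 1) + (L + 2) ≤ _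
    omega

/-! ### Thresholds in classes of large Littlestone dimension -/

variable {X : Type u}

/-- `H` shatters a complete tree of depth `d` all of whose internal nodes have their labels in `P`,
phrased by recursion on the depth: the restrictions of `H` at the root shatter the two subtrees. -/
def ShattersIn (P : Set X) : ℕ → Set (X → Bool) → Prop
  | 0, H => H.Nonempty
  | d + 1, H => ∃ x ∈ P, ShattersIn P d {h ∈ H | h x = false} ∧
      ShattersIn P d {h ∈ H | h x = true}

theorem ShattersIn.mono {P P' : Set X} (hP : P ⊆ P') {d : ℕ} : ∀ {H H' : Set (X → Bool)},
    H ⊆ H' → ShattersIn P d H → ShattersIn P' d H' := by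
  induction d with
  | zero => exact fun hH h => Set.Nonempty.mono hH h
  | succ d ih =>
    rintro H H' hH ⟨x, hx, h0, h1⟩
    exact ⟨x, hP hx, ih (fun g hg => ⟨hH hg.1, hg.2⟩) h0, ih (fun g hg => ⟨hH hg.1, hg.2⟩) h1⟩

theorem ShattersIn.pred {P : Set X} {d : ℕ} {H : Set (X → Bool)} (h : ShattersIn P (d + 1) H) :
    ShattersIn P d H := by
  induction d generalizing H with
  | zero => obtain ⟨x, _, ⟨g, hg⟩, _⟩ := h; exact ⟨g, hg.1⟩
  | succ d ih => obtain ⟨x, hx, h0, h1⟩ := h; exact ⟨x, hx, ih h0, ih h1⟩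

theorem ShattersIn.of_le {P : Set X} {d e : ℕ} (hde : d ≤ e) {H : Set (X → Bool)}
    (h : ShattersIn P e H) : ShattersIn P d H := by
  induction hde with
  | refl => exact h
  | step _ ih => exact ih h.pred

theorem MistakeTree.Shattered.shattersIn {d : ℕ} {T : MistakeTree X d} :
    ∀ {H : Set (X → Bool)}, T.Shattered H → ShattersIn Set.univ d H := by
  induction T with
  | leaf =>
    intro H h
    obtain ⟨g, hg, -⟩ := h [] rfl
    exact ⟨g, hg⟩
  | node x l r ihl ihr =>
    intro H h
    refine ⟨x, trivial, ihl fun p hp => ?_, ihr fun p hp => ?_⟩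
    · obtain ⟨g, hg, he⟩ := h ((x, false) :: p) (Or.inl ⟨p, hp, rfl⟩)
      exact ⟨g, ⟨hg, he (x, false) (by simp)⟩, fun e hep => he e (by simp [hep])⟩
    · obtain ⟨g, hg, he⟩ := h ((x, true) :: p) (Or.inr ⟨p, hp, rfl⟩)
      exact ⟨g, ⟨hg, he (x, true) (by simp)⟩, fun e hep => he e (by simp [hep])⟩

theorem shattersIn_of_le_littlestoneDim {H : Set (X → Bool)} {n : ℕ} (hn : 0 < n)
    (h : (n : ℕ∞) ≤ littlestoneDim H) : ShattersIn Set.univ n H := by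
  by_contra hcon
  have hle : littlestoneDim H ≤ ((n - 1 : ℕ) : ℕ∞) := by
    refine iSup₂_le fun d ⟨T, hT⟩ => ?_
    by_contra hd
    rw [Nat.cast_le] at hd
    exact hcon (hT.shattersIn.of_le (by omega))
  have := Nat.cast_le.mp (h.trans hle)
  omega

/-- Ramsey's theorem for trees: if the labels of a shattered tree are coloured with two colours, a
monochromatic deep tree is shattered as well. -/
theorem ShattersIn.inter_or {P : Set X} (f : X → Bool) {d : ℕ} : ∀ {H : Set (X → Bool)} {p q : ℕ},
    ShattersIn P d H → p + q ≤ d + 1 →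
    ShattersIn (P ∩ {x | f x = true}) p H ∨ ShattersIn (P ∩ {x | f x = false}) q H := by
  have hz : ∀ {d : ℕ} {H : Set (X → Bool)} {P' : Set X},
      ShattersIn P d H → ShattersIn P' 0 H :=
    fun h => h.of_le (Nat.zero_le _)
  induction d with
  | zero =>
    intro H p q h hpq
    obtain rfl | rfl : p = 0 ∨ q = 0 := by omega
    · exact Or.inl (hz h)
    · exact Or.inr (hz h)
  | succ d ih =>
    intro H p q h hpq
    rcases p with _ | p
    · exact Or.inl (hz h)
    rcases q with _ | q
    · exact Or.inr (hz h)
    obtain ⟨x, hx, h0, h1⟩ := h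
    have sub : ∀ b, {g ∈ H | g x = b} ⊆ H := fun b => Set.sep_subset _ _
    cases hfx : f x with
    | true =>
      rcases ih (p := p) (q := q + 1) h0 (by omega) with h0' | h0'
      · rcases ih (p := p) (q := q + 1) h1 (by omega) with h1' | h1'
        · exact Or.inl ⟨x, ⟨hx, hfx⟩, h0', h1'⟩
        · exact Or.inr (h1'.mono subset_rfl (sub _))
      · exact Or.inr (h0'.mono subset_rfl (sub _))
    | false =>
      rcases ih (p := p + 1) (q := q) h0 (by omega) with h0' | h0'
      · exact Or.inl (h0'.mono subset_rfl (sub _))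
      · rcases ih (p := p + 1) (q := q) h1 (by omega) with h1' | h1'
        · exact Or.inl (h1'.mono subset_rfl (sub _))
        · exact Or.inr ⟨x, ⟨hx, hfx⟩, h0', h1'⟩

/-- A class that shatters a tree of depth `2 ^ n - 1` contains `n` thresholds: after sorting, the
`i`-th hypothesis is `true` on the points after the `i`-th one and `false` on those before it. Its
value at the `i`-th point itself is not specified. -/
theorem ShattersIn.exists_list {n : ℕ} : ∀ {P : Set X} {H : Set (X → Bool)},
    ShattersIn P (2 ^ n - 1) H → ∃ l : List (X × (X → Bool)), l.length = n ∧
      (∀ a ∈ l, a.1 ∈ P ∧ a.2 ∈ H) ∧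
      l.Pairwise fun a b => a.2 b.1 = true ∧ b.2 a.1 = false := by
  induction n with
  | zero => exact fun _ => ⟨[], by simp⟩
  | succ n ih =>
    intro P H hd
    obtain ⟨g, hg⟩ : H.Nonempty := hd.of_le (Nat.zero_le _)
    have hpos := Nat.one_le_two_pow (n := n)
    -- All labels of the smaller tree are on one side of `g`, so `g` and the root of that tree
    -- extend the thresholds found below the root at one of the two ends.
    rcases hd.inter_or g (p := 2 ^ n) (q := 2 ^ n) (by rw [pow_succ]; omega) with h | h
    all_goals
      obtain ⟨k, hk⟩ : ∃ k, 2 ^ n = k + 1 := ⟨2 ^ n - 1, by omega⟩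
      rw [hk] at h
      obtain ⟨x, ⟨hx, hgx⟩, h0, h1⟩ := h
      rw [show k = 2 ^ n - 1 by omega] at h0 h1
    · obtain ⟨l, hl, hmem, hpw⟩ := ih h0
      refine ⟨(x, g) :: l, by simp [hl], ?_, List.pairwise_cons.mpr ⟨fun a ha => ?_, hpw⟩⟩
      · simp only [List.mem_cons, forall_eq_or_imp]
        exact ⟨⟨hx, hg⟩, fun a ha => ⟨(hmem a ha).1.1, (hmem a ha).2.1⟩⟩
      · exact ⟨(hmem a ha).1.2, (hmem a ha).2.2⟩
    · obtain ⟨l, hl, hmem, hpw⟩ := ih h1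
      refine ⟨l ++ [(x, g)], by simp [hl], ?_, List.pairwise_append.mpr
        ⟨hpw, List.pairwise_singleton _ _, fun a ha b hb => ?_⟩⟩
      · intro a ha
        rcases List.mem_append.mp ha with ha | ha
        · exact ⟨(hmem a ha).1.1, (hmem a ha).2.1⟩
        · rw [List.mem_singleton.mp ha]; exact ⟨hx, hg⟩
      · rw [List.mem_singleton.mp hb]
        exact ⟨(hmem a ha).2.2, (hmem a ha).1.2⟩

/-- The points `x 0, …, x (n - 1)` and the hypotheses `g 0, …, g (n - 1)` in `H` are `n` thresholds.
The value of `g i` at `x i` is left open. -/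
structure IsThresholds (H : Set (X → Bool)) (n : ℕ) (x : ℕ → X) (g : ℕ → X → Bool) : Prop where
  mem : ∀ i < n, g i ∈ H
  eq_true : ∀ i j, i < j → j < n → g i (x j) = true
  eq_false : ∀ i j, i < j → j < n → g j (x i) = false

theorem ShattersIn.exists_isThresholds {n : ℕ} (hn : 0 < n) {H : Set (X → Bool)}
    (h : ShattersIn Set.univ (2 ^ n) H) : ∃ x g, IsThresholds H n x g := by
  obtain ⟨l, hl, hmem, hpw⟩ := (h.of_le (Nat.sub_le _ 1)).exists_list
  have hl0 : 0 < l.length := hl ▸ hn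
  have hget : ∀ i, i < n → l.getD i l[0] ∈ l ∧ ∀ h : i < l.length, l.getD i l[0] = l[i] := by
    intro i hi
    have hi' : i < l.length := hl ▸ hi
    exact ⟨by simp [hi'], fun h => by simp [h]⟩
  rw [List.pairwise_iff_getElem] at hpw
  refine ⟨fun i => (l.getD i l[0]).1, fun i => (l.getD i l[0]).2,
    fun i hi => (hmem _ (hget i hi).1).2, fun i j hij hj => ?_, fun i j hij hj => ?_⟩
  all_goals
    rw [(hget i (hij.trans hj)).2 (by omega), (hget j hj).2 (by omega)]
  · exact (hpw i j (by omega) (by omega) hij).1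
  · exact (hpw i j (by omega) (by omega) hij).2

/-! ### Large families of indistinguishable distributions on a finite set -/

section FiniteFamilies

variable {V : Type*} [Fintype V]

/-- The expectation of `f` under the `K`-th power of the distribution with weights `p`. -/
def powExp (p : V → ℝ) (K : ℕ) (f : (Fin K → V) → ℝ) : ℝ :=
  ∑ v, (∏ k, p (v k)) * f v

theorem powExp_mono {p : V → ℝ} (hp : ∀ v, 0 ≤ p v) {K : ℕ} {f g : (Fin K → V) → ℝ}
    (h : ∀ v, f v ≤ g v) : powExp p K f ≤ powExp p K g :=
  Finset.sum_le_sum fun v _ =>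
    mul_le_mul_of_nonneg_left (h v) (Finset.prod_nonneg fun _ _ => hp _)

theorem powExp_sum {ι : Type*} (p : V → ℝ) {K : ℕ} (s : Finset ι) (f : ι → (Fin K → V) → ℝ) :
    powExp p K (fun v => ∑ i ∈ s, f i v) = ∑ i ∈ s, powExp p K (f i) := by
  simp only [powExp, Finset.mul_sum]
  exact Finset.sum_comm

theorem powExp_one {p : V → ℝ} (hp : ∑ v, p v = 1) (K : ℕ) : powExp p K (fun _ => 1) = 1 := by
  simp [powExp, ← Fintype.sum_pow, hp]

theorem powExp_succ (p : V → ℝ) (K : ℕ) (f : (Fin (K + 1) → V) → ℝ) :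
    powExp p (K + 1) f = ∑ a, p a * powExp p K (fun v => f (Fin.cons a v)) := by
  simp only [powExp]
  rw [← (Fin.consEquiv fun _ => V).sum_comp, Fintype.sum_prod_type]
  simp [Fin.consEquiv, Fin.prod_univ_succ, Finset.mul_sum, mul_assoc]

/-- Indistinguishability extends from events to test functions with values in `[0, 1]`. -/
theorem sum_mul_le_of_indistinguishable {p q : V → ℝ} {ε δ : ℝ}
    (h : ∀ E : Finset V, ∑ v ∈ E, p v ≤ Real.exp ε * ∑ v ∈ E, q v + δ) {f : V → ℝ}
    (hf0 : ∀ v, 0 ≤ f v) (hf1 : ∀ v, f v ≤ 1) :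
    ∑ v, p v * f v ≤ Real.exp ε * ∑ v, q v * f v + δ := by
  classical
  have key : ∑ v, (p v - Real.exp ε * q v) * f v ≤
      ∑ v ∈ Finset.univ.filter (fun v => 0 ≤ p v - Real.exp ε * q v),
        (p v - Real.exp ε * q v) := by
    rw [Finset.sum_filter]
    refine Finset.sum_le_sum fun v _ => ?_
    split_ifs with h0
    · exact mul_le_of_le_one_right h0 (hf1 v)
    · exact mul_nonpos_of_nonpos_of_nonneg (not_le.mp h0).le (hf0 v)
  have h1 := h (Finset.univ.filter (fun v => 0 ≤ p v - Real.exp ε * q v))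
  simp only [sub_mul, Finset.sum_sub_distrib, ← Finset.mul_sum, mul_assoc] at key
  linarith

/-- Basic composition: `K`-th powers of `(ε, δ)`-indistinguishable distributions are
`(K ε, K δ)`-indistinguishable. -/
theorem powExp_le_of_indistinguishable {p q : V → ℝ} {ε δ : ℝ} (hp : ∀ v, 0 ≤ p v)
    (hq : ∀ v, 0 ≤ q v) (hp1 : ∑ v, p v = 1) (hδ : 0 ≤ δ)
    (h : ∀ E : Finset V, ∑ v ∈ E, p v ≤ Real.exp ε * ∑ v ∈ E, q v + δ) (K : ℕ) :
    ∀ f : (Fin K → V) → ℝ, (∀ v, 0 ≤ f v) → (∀ v, f v ≤ 1) →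
      powExp p K f ≤ Real.exp (K * ε) * powExp q K f + K * δ := by
  induction K with
  | zero => intro f _ _; simp [powExp]
  | succ K ih =>
    intro f hf0 hf1
    set g : V → ℝ := fun a => powExp q K (fun v => f (Fin.cons a v))
    have hg0 : ∀ a, 0 ≤ g a := fun a =>
      Finset.sum_nonneg fun v _ => mul_nonneg (Finset.prod_nonneg fun _ _ => hq _) (hf0 _)
    -- Truncation at `1` makes the bound for the inner expectation a test function again.
    set t : V → ℝ := fun a => min 1 (Real.exp (K * ε) * g a)
    have ht : ∀ a, powExp p K (fun v => f (Fin.cons a v)) ≤ t a + K * δ := by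
      intro a
      have h1 : powExp p K (fun v => f (Fin.cons a v)) ≤ 1 :=
        (powExp_mono hp fun v => hf1 _).trans (powExp_one hp1 K).le
      have h2 := ih (fun v => f (Fin.cons a v)) (fun v => hf0 _) (fun v => hf1 _)
      rw [← min_add_add_right]
      have : 0 ≤ (K : ℝ) * δ := by positivity
      exact le_min (by linarith) h2
    calc powExp p (K + 1) f ≤ ∑ a, p a * (t a + K * δ) := by
          rw [powExp_succ]
          exact Finset.sum_le_sum fun a _ => mul_le_mul_of_nonneg_left (ht a) (hp a)
      _ = ∑ a, p a * t a + K * δ := by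
          simp only [mul_add, Finset.sum_add_distrib, ← Finset.sum_mul, hp1, one_mul]
      _ ≤ (Real.exp ε * ∑ a, q a * t a + δ) + K * δ := by
          gcongr
          exact sum_mul_le_of_indistinguishable h
            (fun a => le_min zero_le_one (mul_nonneg (Real.exp_nonneg _) (hg0 a)))
            (fun a => min_le_left _ _)
      _ ≤ (Real.exp ε * ∑ a, q a * (Real.exp (K * ε) * g a) + δ) + K * δ := by
          gcongr with a
          · exact hq a
          · exact min_le_right _ _
      _ = _ := by
          rw [powExp_succ]
          push_cast
          rw [add_mul, one_mul, Real.exp_add]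
          simp only [mul_left_comm (q _), ← Finset.mul_sum]
          ring

/-- A Hoeffding-type bound, from `exp y ≤ 1 + y + y ^ 2` for `|y| ≤ 1`. -/
theorem powExp_sum_nonneg_le {p : V → ℝ} (hp : ∀ v, 0 ≤ p v) (hp1 : ∑ v, p v = 1) {Z : V → ℝ}
    (hZ : ∀ v, |Z v| ≤ 1) {γ : ℝ} (hγ : 0 < γ) (hmean : ∑ v, p v * Z v ≤ -γ) (K : ℕ) :
    powExp p K (fun v => if 0 ≤ ∑ k, Z (v k) then 1 else 0) ≤ Real.exp (-(K * γ ^ 2 / 4)) := by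
  have hγ1 : γ ≤ 1 := by
    have : -1 ≤ ∑ v, p v * Z v := by
      rw [← hp1, ← Finset.sum_neg_distrib]
      refine Finset.sum_le_sum fun v _ => ?_
      nlinarith [hp v, (abs_le.mp (hZ v)).1]
    linarith
  have hmgf : ∑ v, p v * Real.exp (γ / 2 * Z v) ≤ Real.exp (-(γ ^ 2 / 4)) := by
    have h1 : ∀ v, Real.exp (γ / 2 * Z v) ≤ 1 + γ / 2 * Z v + (γ / 2) ^ 2 := by
      intro v
      have hs : |γ / 2 * Z v| ≤ γ / 2 := by
        rw [abs_mul, abs_of_pos (by positivity)]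
        exact mul_le_of_le_one_right (by positivity) (hZ v)
      have h2 := (abs_le.mp (Real.abs_exp_sub_one_sub_id_le (hs.trans (by linarith)))).2
      have h3 : (γ / 2 * Z v) ^ 2 ≤ (γ / 2) ^ 2 := sq_le_sq' (abs_le.mp hs).1 (abs_le.mp hs).2
      linarith
    calc ∑ v, p v * Real.exp (γ / 2 * Z v)
        ≤ ∑ v, p v * (1 + γ / 2 * Z v + (γ / 2) ^ 2) :=
          Finset.sum_le_sum fun v _ => mul_le_mul_of_nonneg_left (h1 v) (hp v)
      _ = 1 + γ / 2 * ∑ v, p v * Z v + (γ / 2) ^ 2 := by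
          simp only [mul_add, Finset.sum_add_distrib, ← Finset.sum_mul, hp1, mul_one, one_mul,
            mul_left_comm (p _), ← Finset.mul_sum]
      _ ≤ -(γ ^ 2 / 4) + 1 := by nlinarith
      _ ≤ Real.exp (-(γ ^ 2 / 4)) := Real.add_one_le_exp _
  calc powExp p K (fun v => if 0 ≤ ∑ k, Z (v k) then 1 else 0)
      ≤ powExp p K (fun v => ∏ k, Real.exp (γ / 2 * Z (v k))) := by
        refine powExp_mono hp fun v => ?_
        rw [← Real.exp_sum, ← Finset.mul_sum]
        split_ifs with h
        · exact Real.one_le_exp (by positivity)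
        · positivity
    _ = (∑ v, p v * Real.exp (γ / 2 * Z v)) ^ K := by
        simp only [powExp, ← Finset.prod_mul_distrib, Fintype.sum_pow]
    _ ≤ Real.exp (-(γ ^ 2 / 4)) ^ K := by
        gcongr
        exact Finset.sum_nonneg fun v _ => mul_nonneg (hp v) (Real.exp_nonneg _)
    _ = _ := by rw [← Real.exp_nat_mul]; congr 1; ring

/-- The midpoint of the dyadic interval of length `2 ^ (s + 1)` that contains `j`: the points that
a binary search for `j` queries. -/
def searchPoint (j s : ℕ) : ℕ := 2 ^ (s + 1) * (j / 2 ^ (s + 1)) + 2 ^ s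

theorem searchPoint_lt {j s K : ℕ} (hj : j < 2 ^ K) (hs : s < K) : searchPoint j s < 2 ^ K := by
  obtain ⟨e, rfl⟩ : ∃ e, K = s + 1 + e := ⟨K - (s + 1), by omega⟩
  have h1 : j / 2 ^ (s + 1) < 2 ^ e := by
    rw [Nat.div_lt_iff_lt_mul (by positivity), ← pow_add, add_comm]; exact hj
  have h2 : 2 ^ (s + 1) * (j / 2 ^ (s + 1) + 1) ≤ 2 ^ (s + 1) * 2 ^ e := Nat.mul_le_mul_left _ h1
  have h3 : 2 ^ s < 2 ^ (s + 1) := Nat.pow_lt_pow_right (by norm_num) (by omega)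
  rw [pow_add 2 (s + 1) e, searchPoint]
  rw [mul_add, mul_one] at h2
  omega

/-- Two searches that are answered as `j` and `j'` demand part at some common query. -/
theorem exists_searchPoint_separates {j j' K : ℕ} (hj : j < 2 ^ K) (hj' : j' < 2 ^ K)
    (hne : j ≠ j') : ∃ s < K, searchPoint j s = searchPoint j' s ∧
      (j < searchPoint j s ↔ ¬ j' < searchPoint j' s) := by
  have hex : ∃ s, j / 2 ^ s = j' / 2 ^ s := ⟨K, by rw [Nat.div_eq_of_lt hj, Nat.div_eq_of_lt hj']⟩
  obtain ⟨s, hs⟩ : ∃ s, Nat.find hex = s + 1 := by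
    refine Nat.exists_eq_succ_of_ne_zero fun h0 => hne ?_
    simpa [h0] using Nat.find_spec hex
  have heq : j / 2 ^ (s + 1) = j' / 2 ^ (s + 1) := hs ▸ Nat.find_spec hex
  have hns : j / 2 ^ s ≠ j' / 2 ^ s := Nat.find_min hex (by omega)
  have hsK : s + 1 ≤ K := hs ▸ Nat.find_min' hex
    (by rw [Nat.div_eq_of_lt hj, Nat.div_eq_of_lt hj'])
  refine ⟨s, hsK, by rw [searchPoint, searchPoint, heq], ?_⟩
  have hlt : ∀ i, i < searchPoint i s ↔ i / 2 ^ s < 2 * (i / 2 ^ (s + 1)) + 1 := by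
    intro i
    rw [Nat.div_lt_iff_lt_mul (by positivity), searchPoint]
    ring_nf
  rw [hlt, hlt, ← heq]
  have e1 : j / 2 ^ (s + 1) = j / 2 ^ s / 2 := by rw [pow_succ, Nat.div_div_eq_div_mul]
  have e2 : j' / 2 ^ (s + 1) = j' / 2 ^ s / 2 := by rw [pow_succ, Nat.div_div_eq_div_mul]
  omega

/-- There are no `2 ^ K` distributions `w j`, `(1/10, δ)`-indistinguishable from `w 0`, and events `B l`
such that the probability of `B l` under `w j` tells whether `l ≤ j`: binary search in `K`
independent samples finds `j` with constant probability, so that by composition the `2 ^ K` disjoint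
events "the search finds `j`" all have probability `≥ exp (-K / 10) / 2` under `w 0`. -/
theorem no_large_threshold_family {K : ℕ} (hK : 3 ≤ K) {γ δ r : ℝ} (hγ : 0 < γ)
    (hr0 : 0 ≤ r) (hr1 : r ≤ 1) (hδ : 0 ≤ δ) (hKδ : K * δ ≤ 1 / 4)
    (hKγ : K * Real.exp (-(K * γ ^ 2 / 4)) ≤ 1 / 4)
    (w : ℕ → V → ℝ) (hw : ∀ j v, 0 ≤ w j v) (hw1 : ∀ j, ∑ v, w j v = 1)
    (hind : ∀ j < 2 ^ K, ∀ E : Finset V,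
      ∑ v ∈ E, w j v ≤ Real.exp (1 / 10) * ∑ v ∈ E, w 0 v + δ)
    (B : ℕ → V → Bool)
    (hlow : ∀ j < 2 ^ K, ∀ l < 2 ^ K, l ≤ j → ∑ v, (if B l v then w j v else 0) ≤ r - γ)
    (hhigh : ∀ j < 2 ^ K, ∀ l < 2 ^ K, j < l → r + γ ≤ ∑ v, (if B l v then w j v else 0)) :
    False := by
  classical
  set Z : ℕ → V → ℝ := fun l v => (if B l v then 1 else 0) - r with hZdef
  have hZ : ∀ l v, |Z l v| ≤ 1 := by
    intro l v
    rw [abs_le, hZdef]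
    dsimp only
    split_ifs <;> constructor <;> linarith
  have hmean : ∀ j l, ∑ v, w j v * Z l v = ∑ v, (if B l v then w j v else 0) - r := by
    intro j l
    simp only [hZdef, mul_sub, Finset.sum_sub_distrib, ← Finset.sum_mul, hw1, one_mul, mul_ite,
      mul_one, mul_zero]
  -- `ans l v` is the empirical answer to the query `j < l`.
  let ans : ℕ → (Fin K → V) → Prop := fun l v => 0 ≤ ∑ k, Z l (v k)
  let found : ℕ → (Fin K → V) → Prop := fun j v =>
    ∀ s < K, (ans (searchPoint j s) v ↔ j < searchPoint j s)
  have hwrong : ∀ j < 2 ^ K, ∀ l < 2 ^ K,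
      powExp (w j) K (fun v => if (ans l v ↔ j < l) then 0 else 1) ≤
        Real.exp (-(K * γ ^ 2 / 4)) := by
    intro j hj l hl
    rcases lt_or_ge j l with h | h
    · refine le_trans (powExp_mono (hw j) fun v => ?_)
        (powExp_sum_nonneg_le (hw j) (hw1 j) (Z := fun v => -Z l v)
          (fun v => by rw [abs_neg]; exact hZ l v) hγ ?_ K)
      · have : (0 ≤ ∑ k, -Z l (v k)) ↔ ∑ k, Z l (v k) ≤ 0 := by
          rw [Finset.sum_neg_distrib, neg_nonneg]
        simp only [h, iff_true, this, ans]
        split_ifs <;> linarith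
      · simp only [mul_neg, Finset.sum_neg_distrib, hmean]
        have := hhigh j hj l hl h
        linarith
    · refine le_trans (powExp_mono (hw j) fun v => ?_)
        (powExp_sum_nonneg_le (hw j) (hw1 j) (hZ l) hγ ?_ K)
      · simp only [h.not_gt, iff_false, ans]
        split_ifs <;> norm_num
      · rw [hmean]
        have := hlow j hj l hl h
        linarith
  have hfound : ∀ j < 2 ^ K, 3 / 4 ≤ powExp (w j) K (fun v => if found j v then 1 else 0) := by
    intro j hj
    have h1 : (1 : ℝ) ≤ powExp (w j) K (fun v => if found j v then 1 else 0) +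
        ∑ s ∈ Finset.range K, powExp (w j) K
          (fun v => if (ans (searchPoint j s) v ↔ j < searchPoint j s) then 0 else 1) := by
      rw [← powExp_sum]
      refine (powExp_one (hw1 j) K).ge.trans ?_
      simp only [powExp]
      rw [← Finset.sum_add_distrib]
      refine Finset.sum_le_sum fun v _ => ?_
      rw [← mul_add]
      refine mul_le_mul_of_nonneg_left ?_ (Finset.prod_nonneg fun _ _ => hw _ _)
      have hnn : ∀ s ∈ Finset.range K,
          (0 : ℝ) ≤ if (ans (searchPoint j s) v ↔ j < searchPoint j s) then 0 else 1 :=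
        fun s _ => by split_ifs <;> norm_num
      by_cases hf : found j v
      · rw [if_pos hf]
        linarith [Finset.sum_nonneg hnn]
      · rw [if_neg hf, zero_add]
        simp only [found, not_forall] at hf
        obtain ⟨s, hs, hns⟩ := hf
        refine le_trans ?_ (Finset.single_le_sum hnn (Finset.mem_range.mpr hs))
        rw [if_neg hns]
    have h2 : ∑ s ∈ Finset.range K, powExp (w j) K
          (fun v => if (ans (searchPoint j s) v ↔ j < searchPoint j s) then 0 else 1) ≤
        K * Real.exp (-(K * γ ^ 2 / 4)) := by
      refine (Finset.sum_le_card_nsmul _ _ _ fun s hs =>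
        hwrong j hj _ (searchPoint_lt hj (Finset.mem_range.mp hs))).trans_eq ?_
      rw [Finset.card_range, nsmul_eq_mul]
    linarith
  have hzero : ∀ j < 2 ^ K,
      Real.exp (-(K * (1 / 10))) / 2 ≤ powExp (w 0) K (fun v => if found j v then 1 else 0) := by
    intro j hj
    have h1 := powExp_le_of_indistinguishable (hw j) (hw 0) (hw1 j) hδ (hind j hj) K
      (fun v => if found j v then 1 else 0) (fun v => by split_ifs <;> norm_num)
      (fun v => by split_ifs <;> norm_num)
    have h2 := hfound j hj
    have h3 : (1 : ℝ) / 2 ≤ Real.exp (K * (1 / 10)) *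
        powExp (w 0) K (fun v => if found j v then 1 else 0) := by linarith
    rw [Real.exp_neg, div_eq_mul_one_div, inv_mul_le_iff₀ (Real.exp_pos _)]
    exact h3
  have htotal : ∑ j ∈ Finset.range (2 ^ K),
      powExp (w 0) K (fun v => if found j v then 1 else 0) ≤ 1 := by
    rw [← powExp_sum]
    refine le_trans (powExp_mono (hw 0) fun v => ?_) (powExp_one (hw1 0) K).le
    rw [Finset.sum_boole, Nat.cast_le_one, Finset.card_le_one]
    intro j hj j' hj'
    rw [Finset.mem_filter, Finset.mem_range] at hj hj'
    by_contra hne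
    obtain ⟨s, hs, heq, hsep⟩ := exists_searchPoint_separates hj.1 hj'.1 hne
    have h1 := hj.2 s hs
    have h2 := hj'.2 s hs
    rw [heq] at h1 hsep
    tauto
  have hsum : (2 : ℝ) ^ K * (Real.exp (-(K * (1 / 10))) / 2) ≤ 1 := by
    refine le_trans ?_ htotal
    have := Finset.card_nsmul_le_sum (Finset.range (2 ^ K))
      (fun j => powExp (w 0) K (fun v => if found j v then 1 else 0)) _
      (fun j hj => hzero j (Finset.mem_range.mp hj))
    simpa using this
  -- `2 * exp (-1 / 10) ≥ 8 / 5` and `(8 / 5) ^ 3 > 2`.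
  have hexp : (8 / 5 : ℝ) ≤ 2 * Real.exp (-(1 / 10)) := by
    have := Real.add_one_le_exp (-(1 / 10) : ℝ)
    linarith
  have hpow : (8 / 5 : ℝ) ^ K ≤ 2 ^ K * Real.exp (-(K * (1 / 10))) := by
    rw [show -((K : ℝ) * (1 / 10)) = K * (-(1 / 10)) by ring, Real.exp_nat_mul, ← mul_pow]
    gcongr
  have h3 : (8 / 5 : ℝ) ^ 3 ≤ (8 / 5 : ℝ) ^ K := pow_le_pow_right₀ (by norm_num) hK
  norm_num at h3
  linarith

end FiniteFamilies

/-! ### Learners on uniform distributions -/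

/-- Samples from the uniform distribution on the family `f` are families of uniform indices; `f` need
not be injective. -/
theorem tsum_iid_map_uniform {α ι : Type*} [Fintype ι] [Nonempty ι] (f : ι → α) (m : ℕ)
    (F : (Fin m → α) → ℝ≥0∞) :
    ∑' S, iid ((PMF.uniformOfFintype ι).map f) m S * F S =
      (Fintype.card ι : ℝ≥0∞)⁻¹ ^ m * ∑ v : Fin m → ι, F (f ∘ v) := by
  classical
  have h : ∀ S, iid ((PMF.uniformOfFintype ι).map f) m S =
      ∑ v : Fin m → ι, if S = f ∘ v then (Fintype.card ι : ℝ≥0∞)⁻¹ ^ m else 0 := by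
    intro S
    change ∏ i, ((PMF.uniformOfFintype ι).map f) (S i) = _
    simp only [PMF.map_apply, PMF.uniformOfFintype_apply, tsum_fintype, Finset.prod_univ_sum,
      Fintype.piFinset_univ, Finset.prod_ite_zero, Finset.mem_univ, true_imp_iff,
      Finset.prod_const, Finset.card_univ, Fintype.card_fin, funext_iff, Function.comp_apply]
  simp only [h, Finset.sum_mul, ite_mul, zero_mul]
  rw [Summable.tsum_finsetSum fun _ _ => ENNReal.summable, Finset.mul_sum]
  exact Finset.sum_congr rfl fun v _ => tsum_ite_eq _ _

theorem loss_map_uniform {ι : Type*} [Fintype ι] [Nonempty ι] (f : ι → X × Bool) (h : X → Bool) :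
    loss ((PMF.uniformOfFintype ι).map f) h =
      ((Finset.univ.filter fun t => h (f t).1 ≠ (f t).2).card : ℝ≥0∞) / Fintype.card ι := by
  classical
  rw [loss, PMF.toOuterMeasure_map_apply, PMF.toOuterMeasure_uniformOfFintype_apply]
  congr 2
  exact Fintype.card_of_subtype _ (by simp)

theorem measurableSet_of_restrict {ι : Type*} [Finite ι] (y : ι → X) (E : Set (ι → Bool)) :
    MeasurableSet {h : X → Bool | (fun t => h (y t)) ∈ E} :=
  (measurable_pi_lambda (fun (h : X → Bool) (t : ι) => h (y t))
    fun t => measurable_pi_apply (y t)) E.toFinite.measurableSet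

theorem measurableSet_apply_eq (y : X) (b : Bool) : MeasurableSet {h : X → Bool | h y = b} :=
  (measurableSet_singleton b).preimage (measurable_pi_apply y)

variable {m : ℕ}

/-- Accuracy on the uniform distribution on the examples `f t`, `t : ι`: the learner has loss
greater than `1 / 16` on few of the samples. -/
theorem IsAccurate.sum_le {H : Set (X → Bool)} {A : LearningAlgorithm X m}
    (hA : IsAccurate H (1 / 16) (1 / 16) A) {ι : Type*} [Fintype ι] [Nonempty ι]
    (f : ι → X × Bool) (hf : ∃ g ∈ H, ∀ t, g (f t).1 = (f t).2) :
    ∑ v : Fin m → ι, (A (f ∘ v) {h | Fintype.card ι <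
        16 * (Finset.univ.filter fun t => h (f t).1 ≠ (f t).2).card} : ℝ) ≤
      (Fintype.card ι : ℝ) ^ m / 16 := by
  obtain ⟨g, hg, hgf⟩ := hf
  have hcard : (Fintype.card ι : ℝ≥0∞) ≠ 0 := by simp
  have h := hA ((PMF.uniformOfFintype ι).map f) ⟨g, hg, by simp [loss_map_uniform, hgf]⟩
  have hset : {h | (1 / 16 : ℝ≥0∞) < loss ((PMF.uniformOfFintype ι).map f) h} =
      {h | Fintype.card ι < 16 * (Finset.univ.filter fun t => h (f t).1 ≠ (f t).2).card} := by
    ext h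
    simp only [Set.mem_ofPred_eq, loss_map_uniform]
    rw [ENNReal.lt_div_iff_mul_lt (Or.inl hcard) (Or.inl (by simp)), one_div, mul_comm,
      ← div_eq_mul_inv, ENNReal.div_lt_iff (Or.inl (by norm_num)) (Or.inl (by norm_num)), mul_comm]
    exact_mod_cast Iff.rfl
  rw [hset, tsum_iid_map_uniform, ← ENNReal.inv_pow, mul_comm, ← div_eq_mul_inv,
    ENNReal.div_le_iff (by simp) (by simp), one_div, mul_comm, ← div_eq_mul_inv] at h
  have h2 := ENNReal.toReal_mono (by
    exact ENNReal.div_ne_top (by simp) (by norm_num)) h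
  rw [ENNReal.toReal_sum (fun v _ => by simp), ENNReal.toReal_div] at h2
  refine le_trans (le_of_eq ?_) (h2.trans (le_of_eq ?_))
  · rfl
  · simp

/-- The probability that the hypothesis that `A` outputs on the sample `S` is `true` at `y`. -/
noncomputable def trueProb (A : LearningAlgorithm X m) (S : Fin m → X × Bool) (y : X) : ℝ :=
  A S {h | h y = true}

theorem trueProb_nonneg (A : LearningAlgorithm X m) (S : Fin m → X × Bool) (y : X) :
    0 ≤ trueProb A S y := NNReal.coe_nonneg _

theorem trueProb_le_one (A : LearningAlgorithm X m) (S : Fin m → X × Bool) (y : X) :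
    trueProb A S y ≤ 1 := (A S).apply_le_one _

theorem apply_ne_false (A : LearningAlgorithm X m) (S : Fin m → X × Bool) (y : X) :
    (A S {h | h y ≠ false} : ℝ) = trueProb A S y := by
  simp [trueProb]

theorem apply_ne_true (A : LearningAlgorithm X m) (S : Fin m → X × Bool) (y : X) :
    (A S {h | h y ≠ true} : ℝ) = 1 - trueProb A S y :=
  MeasureTheory.probReal_compl_eq_one_sub (measurableSet_apply_eq y true)

/-- The expected loss of an accurate learner on the uniform distribution on the examples `f t`. -/
theorem IsAccurate.sum_sum_le {H : Set (X → Bool)} {A : LearningAlgorithm X m}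
    (hA : IsAccurate H (1 / 16) (1 / 16) A) {ι : Type*} [Fintype ι] [Nonempty ι]
    (f : ι → X × Bool) (hf : ∃ g ∈ H, ∀ t, g (f t).1 = (f t).2) :
    ∑ v : Fin m → ι, ∑ t, (A (f ∘ v) {h | h (f t).1 ≠ (f t).2} : ℝ) ≤
      (Fintype.card ι : ℝ) ^ m * Fintype.card ι / 8 := by
  set M : ℝ := ((Fintype.card ι : ℕ) : ℝ) with hM
  set bad : Set (X → Bool) := {h | Fintype.card ι <
    16 * (Finset.univ.filter fun t => h (f t).1 ≠ (f t).2).card} with hbad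
  have hbadm : MeasurableSet bad :=
    measurableSet_of_restrict (fun t => (f t).1) {c | Fintype.card ι <
      16 * (Finset.univ.filter fun t => c t ≠ (f t).2).card}
  have hEm : ∀ t, MeasurableSet {h : X → Bool | h (f t).1 ≠ (f t).2} := fun t =>
    (measurableSet_apply_eq _ _).compl
  -- The expected number of errors is at most `M / 16` plus `M` times the probability of `bad`.
  have key : ∀ v : Fin m → ι, ∑ t, (A (f ∘ v) {h | h (f t).1 ≠ (f t).2} : ℝ) ≤
      M / 16 + M * A (f ∘ v) bad := by
    intro v
    set μ := (A (f ∘ v) : MeasureTheory.Measure (X → Bool))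
    have hμ : ∀ E : Set (X → Bool), (A (f ∘ v) E : ℝ) = μ.real E := fun _ => rfl
    have hint : ∀ {E : Set (X → Bool)}, MeasurableSet E →
        MeasureTheory.Integrable (E.indicator (1 : (X → Bool) → ℝ)) μ := fun hE =>
      (MeasureTheory.integrable_const (1 : ℝ)).indicator hE
    simp only [hμ]
    calc ∑ t, μ.real {h | h (f t).1 ≠ (f t).2}
        = ∫ h, ∑ t, {h : X → Bool | h (f t).1 ≠ (f t).2}.indicator (1 : (X → Bool) → ℝ) h ∂μ := by
          rw [MeasureTheory.integral_finsetSum _ fun t _ => hint (hEm t)]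
          simp only [MeasureTheory.integral_indicator_one (hEm _)]
      _ ≤ ∫ h, (M / 16 + M * bad.indicator (1 : (X → Bool) → ℝ) h) ∂μ := by
          refine MeasureTheory.integral_mono
            (MeasureTheory.integrable_finsetSum _ fun t _ => hint (hEm t))
            ((MeasureTheory.integrable_const _).add ((hint hbadm).const_mul M)) fun h => ?_
          have hsum : ∑ t, {h : X → Bool | h (f t).1 ≠ (f t).2}.indicator
              (1 : (X → Bool) → ℝ) h =
              ((Finset.univ.filter fun t => h (f t).1 ≠ (f t).2).card : ℝ) := by
            rw [Finset.card_filter]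
            push_cast
            refine Finset.sum_congr rfl fun t _ => ?_
            simp [Set.indicator_apply]
          dsimp only
          rw [hsum]
          by_cases hb : h ∈ bad
          · rw [Set.indicator_of_mem hb, Pi.one_apply, mul_one]
            have : ((Finset.univ.filter fun t => h (f t).1 ≠ (f t).2).card : ℝ) ≤ M := by
              rw [hM]
              exact_mod_cast Finset.card_le_univ (Finset.univ.filter fun t => h (f t).1 ≠ (f t).2)
            have : 0 ≤ M := Nat.cast_nonneg _
            linarith
          · rw [Set.indicator_of_notMem hb, mul_zero, add_zero, le_div_iff₀ (by norm_num), hM]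
            rw [hbad, Set.mem_ofPred_eq, not_lt] at hb
            rw [mul_comm]
            exact_mod_cast hb
      _ = M / 16 + M * μ.real bad := by
          rw [MeasureTheory.integral_add (MeasureTheory.integrable_const _)
            ((hint hbadm).const_mul M),
            MeasureTheory.integral_const_mul, MeasureTheory.integral_indicator_one hbadm]
          simp
  refine (Finset.sum_le_sum fun v _ => key v).trans ?_
  rw [Finset.sum_add_distrib, ← Finset.mul_sum]
  have h1 := mul_le_mul_of_nonneg_left (hA.sum_le f hf) (Nat.cast_nonneg (α := ℝ) (Fintype.card ι))
  rw [← hM] at h1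
  simp only [Finset.sum_const, Finset.card_univ, Fintype.card_fun, Fintype.card_fin, nsmul_eq_mul]
  push_cast
  rw [← hM]
  linarith

/-- Fewer than three examples do not suffice for a class of Littlestone dimension two. -/
theorem IsAccurate.two_lt {H : Set (X → Bool)} {A : LearningAlgorithm X m}
    (hA : IsAccurate H (1 / 16) (1 / 16) A) (hH : ShattersIn Set.univ 2 H) : 2 < m := by
  obtain ⟨x, -, ⟨y, -, ⟨g0, hg0, hg0y⟩, ⟨g1, hg1, hg1y⟩⟩, -⟩ := hH
  -- With probability `2 ^ (-m)` all examples are `(x, false)`; the label of `y` is then unknown.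
  have key : ∀ c : Bool, (∃ g ∈ H, g x = false ∧ g y = c) →
      (A (fun _ => (x, false)) {h | h y ≠ c} : ℝ) ≤ 2 ^ m / 16 := by
    rintro c ⟨g, hg, hgx, hgy⟩
    have h := hA.sum_le (fun t : Bool => if t then (y, c) else (x, false))
      ⟨g, hg, by simp [hgx, hgy]⟩
    rw [Fintype.card_bool] at h
    refine le_trans ?_ h
    refine le_trans ?_ (Finset.single_le_sum (fun v _ => NNReal.coe_nonneg _)
      (Finset.mem_univ (fun _ : Fin m => false)))
    norm_cast
    refine (A _).apply_mono fun h hh => ?_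
    refine lt_of_lt_of_le (by norm_num : 2 < 16 * 1)
      (Nat.mul_le_mul_left 16 (Finset.card_pos.mpr ⟨true, ?_⟩))
    simpa using hh
  have h0 := key false ⟨g0, hg0.1, hg0.2, hg0y⟩
  have h1 := key true ⟨g1, hg1.1, hg1.2, hg1y⟩
  rw [apply_ne_false] at h0
  rw [apply_ne_true] at h1
  by_contra hm
  have : (2 : ℝ) ^ m ≤ 2 ^ 2 := pow_le_pow_right₀ (by norm_num) (by omega)
  linarith

/-! ### Homogeneous sets for a learner -/

/-- The sample of the points with indices `s 0, …, s (m - 1)`, arranged by `σ`, where the label of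
the point with index `s l` is `true` for `κ ≤ l`. -/
def orderedSample (x : ℕ → X) (s : Fin m → ℕ) (σ : Fin m → Fin m) (κ : Fin (m + 1)) :
    Fin m → X × Bool :=
  fun j => (x (s (σ j)), decide ((κ : ℕ) ≤ σ j))

/-- On the points `x 0, …, x (N - 1)` the probability that `A` labels a test point outside an
ordered sample `true` depends, up to `η`, only on the arrangement `σ` of the sample, the
number `κ` of its negative labels and the rank `i` of the test point, through the function `p`.

The sorted sequence `e` consists of the points of the sample and, at `i`, the test point. -/
def IsHomogeneous (A : LearningAlgorithm X m) (x : ℕ → X) (N : ℕ) (η : ℝ)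
    (p : (Fin m → Fin m) → Fin (m + 1) → Fin (m + 1) → ℝ) : Prop :=
  ∀ σ κ i (e : Fin (m + 1) → ℕ), StrictMono e → (∀ l, e l < N) →
    p σ κ i ≤ trueProb A (orderedSample x (e ∘ i.succAbove) σ κ) (x (e i)) ∧
      trueProb A (orderedSample x (e ∘ i.succAbove) σ κ) (x (e i)) ≤ p σ κ i + η

/-- Ramsey's theorem, with the rounded predictions of the learner as colours, gives a homogeneous
subsequence of a long sequence of thresholds. -/
theorem IsThresholds.exists_isHomogeneous {H : Set (X → Bool)} {n N R q : ℕ} {x : ℕ → X}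
    {g : ℕ → X → Bool} (h : IsThresholds H n x g) (A : LearningAlgorithm X m) (hR : 0 < R)
    (hq2 : 2 ≤ q) (hq : (R + 1) ^ (m ^ m * (m + 1) * (m + 1)) ≤ q)
    (hn : ramseyBound q N (m + 1) ≤ n) :
    ∃ x' g', IsThresholds H N x' g' ∧ ∃ p, (∀ σ κ i, 0 ≤ p σ κ i) ∧
      IsHomogeneous A x' N (1 / R) p := by
  classical
  have hR' : (0 : ℝ) < R := by exact_mod_cast hR
  let val : (Fin (m + 1) → ℕ) → ((Fin m → Fin m) × Fin (m + 1)) × Fin (m + 1) → ℝ :=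
    fun e t => trueProb A (orderedSample x (e ∘ t.2.succAbove) t.1.1 t.1.2) (x (e t.2))
  have hval : ∀ e t, ⌊val e t * R⌋₊ < R + 1 := fun e t => by
    rw [Nat.lt_succ_iff]
    refine Nat.floor_le_of_le ?_
    exact mul_le_of_le_one_left hR'.le (trueProb_le_one _ _ _)
  -- Sets of a cardinality other than `m + 1` get an arbitrary colour.
  let c : Finset ℕ → ((Fin m → Fin m) × Fin (m + 1)) × Fin (m + 1) → Fin (R + 1) := fun I t =>
    if hI : I.card = m + 1 then ⟨⌊val (I.orderEmbOfFin hI) t * R⌋₊, hval _ _⟩ else 0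
  obtain ⟨B, hB, hBN, z, hz⟩ := exists_homogeneous (N := N) hq2 (le_trans (by simp) hq) (m + 1) c
    (Finset.range n) (by simpa using hn)
  let b : ℕ → ℕ := fun j => if hj : j < N then B.orderEmbOfFin hBN ⟨j, hj⟩ else 0
  have hbB : ∀ j, j < N → b j ∈ B := fun j hj => by
    simp only [b, hj, dif_pos]; exact B.orderEmbOfFin_mem hBN _
  have hbn : ∀ j, j < N → b j < n := fun j hj => Finset.mem_range.mp (hB (hbB j hj))
  have hbmono : ∀ i j, i < j → j < N → b i < b j := fun i j hij hj => by
    simp only [b, hj, hij.trans hj, dif_pos]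
    exact (B.orderEmbOfFin hBN).strictMono hij
  refine ⟨x ∘ b, g ∘ b, ⟨fun i hi => h.mem _ (hbn i hi),
    fun i j hij hj => h.eq_true _ _ (hbmono i j hij hj) (hbn j hj),
    fun i j hij hj => h.eq_false _ _ (hbmono i j hij hj) (hbn j hj)⟩,
    fun σ κ i => (z ((σ, κ), i) : ℕ) / R, fun σ κ i => by positivity, ?_⟩
  intro σ κ i e he heN
  have hbe : StrictMono (b ∘ e) := fun k l hkl => hbmono _ _ (he hkl) (heN l)
  set I : Finset ℕ := Finset.univ.image (b ∘ e)
  have hIcard : I.card = m + 1 := by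
    rw [Finset.card_image_of_injective _ hbe.injective, Finset.card_univ, Fintype.card_fin]
  have hI : I ⊆ B := by
    intro y hy
    obtain ⟨l, -, rfl⟩ := Finset.mem_image.mp hy
    exact hbB _ (heN l)
  have hemb : b ∘ e = I.orderEmbOfFin hIcard :=
    Finset.orderEmbOfFin_unique hIcard
      (fun l => Finset.mem_image_of_mem _ (Finset.mem_univ l)) hbe
  have hzv : (z ((σ, κ), i) : ℕ) = ⌊val (b ∘ e) ((σ, κ), i) * R⌋₊ := by
    rw [← hz I hI hIcard]
    simp only [c, hIcard, dif_pos, hemb]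
  have hnn : 0 ≤ val (b ∘ e) ((σ, κ), i) * R := mul_nonneg (trueProb_nonneg _ _ _) hR'.le
  change _ ≤ val (b ∘ e) ((σ, κ), i) ∧ val (b ∘ e) ((σ, κ), i) ≤ _
  dsimp only
  rw [hzv, ← add_div]
  exact ⟨(div_le_iff₀ hR').mpr (Nat.floor_le hnn),
    (le_div_iff₀ hR').mpr (Nat.lt_floor_add_one _).le⟩

/-- Inserting a new point into a sorted sequence. -/
theorem exists_strictMono_insert {s : Fin m → ℕ} (hs : StrictMono s) {y : ℕ}
    (hy : ∀ l, s l ≠ y) : ∃ (e : Fin (m + 1) → ℕ) (i : Fin (m + 1)), StrictMono e ∧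
      e ∘ i.succAbove = s ∧ e i = y := by
  have hinj : Function.Injective (Fin.cons y s : Fin (m + 1) → ℕ) :=
    Fin.cons_injective_iff.mpr ⟨fun ⟨l, hl⟩ => hy l hl, hs.injective⟩
  set v : Fin (m + 1) → ℕ := Fin.cons y s with hv
  have he : StrictMono (v ∘ Tuple.sort v) :=
    (Tuple.monotone_sort v).strictMono_of_injective (hinj.comp (Tuple.sort v).injective)
  refine ⟨v ∘ Tuple.sort v, (Tuple.sort v).symm 0, he, ?_, by simp [hv]⟩
  refine (StrictMono.range_inj (he.comp (Fin.strictMono_succAbove _)) hs).mp ?_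
  rw [Set.range_comp, Fin.range_succAbove, Set.image_compl_eq_range_sdiff_image he.injective,
    EquivLike.range_comp, Set.image_singleton, hv, Fin.range_cons]
  have hy' : y ∉ Set.range s := fun ⟨l, hl⟩ => hy l hl
  simp [hy']

/-- Any sample of distinct points labelled by a threshold is an ordered sample. -/
theorem exists_orderedSample {v : Fin m → ℕ} (hv : Function.Injective v) (a : ℕ) :
    ∃ (s : Fin m → ℕ) (σ : Fin m → Fin m) (κ : Fin (m + 1)), StrictMono s ∧
      Function.Bijective σ ∧ v = s ∘ σ ∧ ∀ l : Fin m, (κ : ℕ) ≤ l ↔ a ≤ s l := by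
  have hs : StrictMono (v ∘ Tuple.sort v) :=
    (Tuple.monotone_sort v).strictMono_of_injective (hv.comp (Tuple.sort v).injective)
  have hex : ∃ k, m ≤ k ∨ ∃ h : k < m, a ≤ v (Tuple.sort v ⟨k, h⟩) := ⟨m, Or.inl le_rfl⟩
  classical
  refine ⟨v ∘ Tuple.sort v, (Tuple.sort v).symm,
    ⟨Nat.find hex, Nat.lt_succ_of_le (Nat.find_min' hex (Or.inl le_rfl))⟩, hs,
    (Tuple.sort v).symm.bijective, by ext; simp, fun l => ⟨fun hl => ?_, fun hl => ?_⟩⟩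
  · dsimp only at hl
    rcases Nat.find_spec hex with h | ⟨h, h'⟩
    · exact absurd (h.trans hl) (not_le.mpr l.2)
    · refine h'.trans (hs.monotone (a := ⟨Nat.find hex, h⟩) (b := l) hl)
  · exact Nat.find_min' hex (Or.inr ⟨l.2, hl⟩)

/-! ### Accuracy forces a jump -/

/-- Small steps add up to a small difference. Only increases are bounded, so this is one-sided. -/
theorem le_add_mul_of_step_le {p : Fin (m + 1) → ℝ} {G : ℝ} (hG : 0 ≤ G)
    (h : ∀ i : Fin m, p i.succ ≤ p i.castSucc + G) {i j : Fin (m + 1)} (hij : i ≤ j) :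
    p j ≤ p i + m * G := by
  have key : ∀ k : ℕ, ∀ hk : i + k < m + 1, p ⟨i + k, hk⟩ ≤ p i + k * G := by
    intro k
    induction k with
    | zero => intro _; simp
    | succ k ih =>
      intro hk
      have h1 := ih (by omega)
      have h2 := h ⟨i + k, by omega⟩
      simp only [Fin.succ_mk, Fin.castSucc_mk, add_assoc] at h2
      push_cast
      linarith
  have h1 := key (j - i) (by have := j.2; have : (i : ℕ) ≤ j := hij; omega)
  have hji : (⟨i + (j - i), by have := j.2; have : (i : ℕ) ≤ j := hij; omega⟩ : Fin (m + 1)) = j :=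
    Fin.ext (by have : (i : ℕ) ≤ j := hij; simp only; omega)
  rw [hji] at h1
  have h2 : ((j - i : ℕ) : ℝ) ≤ m := by exact_mod_cast (by have := j.2; omega : (j - i : ℕ) ≤ m)
  have := mul_le_mul_of_nonneg_right h2 hG
  linarith

/-- For a sample of distinct points that is labelled by the threshold `a`, and a negative and a
positive test point outside the sample, the error probabilities add up to almost `1 / 2` unless the
function `p` jumps. -/
theorem IsHomogeneous.error_ge {A : LearningAlgorithm X m} {x : ℕ → X} {N : ℕ} {η G : ℝ}
    {p : (Fin m → Fin m) → Fin (m + 1) → Fin (m + 1) → ℝ} (hp : IsHomogeneous A x N η p)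
    (hG : 0 ≤ G)
    (hstep : ∀ σ κ (i : Fin m), Function.Bijective σ → p σ κ i.succ ≤ p σ κ i.castSucc + G)
    {v : Fin m → ℕ} (hv : Function.Injective v) (hvN : ∀ j, v j < N) {a y y' : ℕ} (hy : y < a)
    (hy' : a ≤ y') (hyN' : y' < N) (hvy : ∀ j, v j ≠ y) (hvy' : ∀ j, v j ≠ y') :
    1 - m * G - η ≤ trueProb A (fun j => (x (v j), decide (a ≤ v j))) (x y) +
      (1 - trueProb A (fun j => (x (v j), decide (a ≤ v j))) (x y')) := by
  obtain ⟨s, σ, κ, hs, hσ, rfl, hκ⟩ := exists_orderedSample hv a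
  have hS : (fun j => (x ((s ∘ σ) j), decide (a ≤ (s ∘ σ) j))) = orderedSample x s σ κ := by
    funext j
    simp only [orderedSample, hκ, Function.comp_apply]
  have hsurj : ∀ l, ∃ j, σ j = l := hσ.2
  have hsN : ∀ l, s l < N := fun l => by obtain ⟨j, rfl⟩ := hsurj l; exact hvN j
  have hsy : ∀ l, s l ≠ y := fun l => by obtain ⟨j, rfl⟩ := hsurj l; exact hvy j
  have hsy' : ∀ l, s l ≠ y' := fun l => by obtain ⟨j, rfl⟩ := hsurj l; exact hvy' j
  obtain ⟨e, i, he, hei, rfl⟩ := exists_strictMono_insert hs hsy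
  obtain ⟨e', i', he', hei', rfl⟩ := exists_strictMono_insert hs hsy'
  have heN : ∀ l, e l < N := fun l => by
    rcases Fin.eq_self_or_eq_succAbove i l with rfl | ⟨k, rfl⟩
    · omega
    · rw [← Function.comp_apply (f := e), hei]; exact hsN k
  have heN' : ∀ l, e' l < N := fun l => by
    rcases Fin.eq_self_or_eq_succAbove i' l with rfl | ⟨k, rfl⟩
    · omega
    · rw [← Function.comp_apply (f := e'), hei']; exact hsN k
  have h1 := (hp σ κ i e he heN).1
  have h2 := (hp σ κ i' e' he' heN').2
  rw [hei] at h1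
  rw [hei'] at h2
  -- The negative test point has a rank at most `κ`, the positive one at least `κ`.
  have hiκ : i ≤ κ := by
    by_contra hlt
    rw [not_le] at hlt
    have hκm : (κ : ℕ) < m := by have := i.2; have : (κ : ℕ) < i := hlt; omega
    have h3 := (hκ ⟨κ, hκm⟩).mp le_rfl
    rw [← hei, Function.comp_apply, Fin.succAbove_of_castSucc_lt _ _ (by exact hlt)] at h3
    have := he (a := Fin.castSucc ⟨κ, hκm⟩) (b := i) hlt
    omega
  have hκi : κ ≤ i' := by
    by_contra hlt
    rw [not_le] at hlt
    have him : (i' : ℕ) < m := by have := κ.2; have : (i' : ℕ) < κ := hlt; omega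
    have h3 : ¬ a ≤ s ⟨i', him⟩ := fun h => by
      have := (hκ ⟨i', him⟩).mpr h
      have : (i' : ℕ) < κ := hlt
      simp only at *
      omega
    rw [← hei', Function.comp_apply, Fin.succAbove_of_le_castSucc _ _ (by exact le_rfl)] at h3
    have := he' (a := i') (b := Fin.succ ⟨i', him⟩) (Nat.lt_succ_self _)
    omega
  have h4 := le_add_mul_of_step_le hG (fun i => hstep σ κ i hσ) (hiκ.trans hκi)
  rw [hS]
  linarith

/-- Most functions from a small set to a large set are injective. -/
theorem card_injective_ge {ι : Type*} [Fintype ι] [DecidableEq ι]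
    (hι : 16 * m ^ 2 ≤ Fintype.card ι) (hm : 0 < m) :
    15 / 16 * (Fintype.card ι : ℝ) ^ m ≤
      ((Finset.univ.filter fun v : Fin m → ι => Function.Injective v).card : ℝ) := by
  have h1 : (Finset.univ.filter fun v : Fin m → ι => Function.Injective v).card =
      (Fintype.card ι).descFactorial m := by
    rw [← Fintype.card_subtype, ← Fintype.card_congr (Equiv.subtypeInjectiveEquivEmbedding _ _).symm,
      Fintype.card_embedding_eq, Fintype.card_fin]
  set M := Fintype.card ι
  have hmM : m ≤ M := by nlinarith
  have hM : (0 : ℝ) < M := by exact_mod_cast hm.trans_le hmM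
  rw [h1]
  have h2 : ((M + 1 - m : ℕ) : ℝ) ^ m ≤ (M.descFactorial m : ℝ) := by
    exact_mod_cast Nat.pow_sub_le_descFactorial M m
  refine le_trans ?_ h2
  -- Bernoulli's inequality: `(1 - m / M) ^ m ≥ 1 - m ^ 2 / M`.
  have h3 : (M : ℝ) * (1 + -(m / M)) ≤ ((M + 1 - m : ℕ) : ℝ) := by
    rw [Nat.cast_sub (by omega)]
    push_cast
    have : (M : ℝ) * (1 + -(m / M)) = M - m := by field_simp; ring
    linarith
  have hmM' : (m : ℝ) / M ≤ 1 := (div_le_one hM).mpr (by exact_mod_cast hmM)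
  refine le_trans ?_ (pow_le_pow_left₀ (mul_nonneg hM.le (by linarith)) h3 m)
  rw [mul_pow, mul_comm]
  refine mul_le_mul_of_nonneg_left ?_ (by positivity)
  refine le_trans ?_ (one_add_mul_le_pow (by linarith) m)
  have : (m : ℝ) * (m / M) ≤ 1 / 16 := by
    rw [← mul_div_assoc, div_le_div_iff₀ hM (by norm_num)]
    have : (16 * m ^ 2 : ℝ) ≤ M := by exact_mod_cast hι
    nlinarith
  linarith

/-- An accurate learner has to raise its prediction substantially at some point of a sample: a test
point just to the right of it is labelled `true` more often than one just to the left. -/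
theorem exists_jump {H : Set (X → Bool)} {A : LearningAlgorithm X m} {x : ℕ → X} {N : ℕ}
    {g : ℕ → X → Bool} {p : (Fin m → Fin m) → Fin (m + 1) → Fin (m + 1) → ℝ} (hm : 0 < m)
    (hA : IsAccurate H (1 / 16) (1 / 16) A) (hx : IsThresholds H N x g)
    (hp : IsHomogeneous A x N (1 / (8 * m)) p) (hN : 16 * m ^ 2 + 1 ≤ N) :
    ∃ σ κ, ∃ i : Fin m, Function.Bijective σ ∧
      p σ κ i.castSucc + 1 / (2 * m) ≤ p σ κ i.succ := by
  classical
  by_contra! hno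
  have hm' : (1 : ℝ) ≤ m := by exact_mod_cast hm
  set a := 8 * m ^ 2 with ha
  have ha0 : 0 < a := by positivity
  have : Nonempty (Fin a) := ⟨⟨0, ha0⟩⟩
  -- The negative examples have indices below `a`, the positive ones above; the threshold function
  -- `g a` is not controlled at the index `a` itself.
  let ind : Fin a × Bool → ℕ := fun t => if t.2 then a + 1 + t.1 else t.1
  let f : Fin a × Bool → X × Bool := fun t => (x (ind t), t.2)
  have hind : Function.Injective ind := by
    rintro ⟨t, b⟩ ⟨t', b'⟩ h
    have := t.2
    have := t'.2
    cases b <;> cases b' <;> simp [ind] at h <;> first | omega | simp [Fin.ext_iff, h]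
  have hindN : ∀ t, ind t < N := by
    rintro ⟨t, b⟩
    have := t.2
    cases b <;> simp [ind] <;> omega
  have hlab : ∀ t, decide (a ≤ ind t) = t.2 := by
    rintro ⟨t, b⟩
    have := t.2
    cases b
    · simp [ind]
    · simp [ind]; omega
  have hcard : Fintype.card (Fin a × Bool) = 2 * a := by simp [mul_comm]
  have hloss := hA.sum_sum_le f ⟨g a, hx.mem a (by omega), by
    rintro ⟨t, b⟩
    have := t.2
    cases b
    · exact hx.eq_false _ _ (by simp [ind]) (by omega)
    · exact hx.eq_true _ _ (by simp [ind]; omega) (by simp [ind]; omega)⟩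
  have hlow : ∀ v : Fin m → Fin a × Bool, Function.Injective v →
      (a - m) * (3 / 8) ≤ ∑ t, (A (f ∘ v) {h | h (f t).1 ≠ (f t).2} : ℝ) := by
    intro v hv
    have hS : f ∘ v = fun j => (x (ind (v j)), decide (a ≤ ind (v j))) := by
      funext j
      simp only [Function.comp_apply, f, hlab]
    rw [Fintype.sum_prod_type]
    simp only [Fintype.sum_bool, f, apply_ne_true, apply_ne_false]
    -- Pair the `t`-th negative with the `t`-th positive point; at most `m` pairs meet the sample.
    set hit : Finset (Fin a) := Finset.univ.image fun j => (v j).1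
    have hhit : (hit.card : ℝ) ≤ m := by
      exact_mod_cast Finset.card_image_le.trans (by simp)
    have hcompl : ((a : ℝ) - m) ≤ (hitᶜ.card : ℝ) := by
      rw [Finset.card_compl, Fintype.card_fin, Nat.cast_sub (by
        simpa using Finset.card_le_univ hit)]
      linarith
    calc ((a : ℝ) - m) * (3 / 8) ≤ hitᶜ.card * (3 / 8) := by gcongr
      _ = ∑ t ∈ hitᶜ, (3 / 8 : ℝ) := by rw [Finset.sum_const, nsmul_eq_mul]
      _ ≤ ∑ t ∈ hitᶜ, ((1 - trueProb A (f ∘ v) (x (ind (t, true)))) +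
          trueProb A (f ∘ v) (x (ind (t, false)))) := by
          refine Finset.sum_le_sum fun t ht => ?_
          have hvt : ∀ b j, ind (v j) ≠ ind (t, b) := fun b j h => by
            rw [Finset.mem_compl] at ht
            exact ht (Finset.mem_image.mpr ⟨j, Finset.mem_univ _, by rw [hind h]⟩)
          have h1 := hp.error_ge (G := 1 / (2 * m)) (by positivity)
            (fun σ κ i hσ => (hno σ κ i hσ).le) (v := ind ∘ v) (hind.comp hv)
            (fun j => hindN _) (a := a) (y := ind (t, false)) (y' := ind (t, true))
            (by simp [ind]) (by simp [ind]; omega) (hindN _) (hvt _) (hvt _)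
          simp only [Function.comp_apply, ← hS] at h1
          have h2 : (m : ℝ) * (1 / (2 * m)) = 1 / 2 := by field_simp
          have h3 : 1 / (8 * (m : ℝ)) ≤ 1 / 8 := by
            apply one_div_le_one_div_of_le <;> linarith
          linarith
      _ ≤ _ := by
          refine Finset.sum_le_univ_sum_of_nonneg fun t => ?_
          have := trueProb_le_one A (f ∘ v) (x (ind (t, true)))
          have := trueProb_nonneg A (f ∘ v) (x (ind (t, false)))
          linarith
  have hinj := card_injective_ge (m := m) (ι := Fin a × Bool) (by rw [hcard, ha]; omega) hm
  have hma : (m : ℝ) ≤ a / 8 := by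
    rw [ha]; push_cast; nlinarith
  have hsum : ((Finset.univ.filter fun v : Fin m → Fin a × Bool => Function.Injective v).card : ℝ) *
      ((a - m) * (3 / 8)) ≤ ∑ v : Fin m → Fin a × Bool,
        ∑ t, (A (f ∘ v) {h | h (f t).1 ≠ (f t).2} : ℝ) := by
    rw [← nsmul_eq_mul, ← Finset.sum_const, Finset.sum_filter]
    refine Finset.sum_le_sum fun v _ => ?_
    split_ifs with hv
    · exact hlow v hv
    · exact Finset.sum_nonneg fun t _ => NNReal.coe_nonneg _
  have h0 : (0 : ℝ) ≤ (a - m) * (3 / 8) := by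
    have : (0 : ℝ) ≤ a := Nat.cast_nonneg _
    linarith
  have h1 := (mul_le_mul_of_nonneg_right hinj h0).trans (hsum.trans hloss)
  rw [hcard] at h1
  push_cast at h1
  have ha' : (0 : ℝ) < a := by exact_mod_cast ha0
  have hpow : (0 : ℝ) < (2 * a) ^ m := by positivity
  have h2 : (2 * (a : ℝ)) ^ m * (15 / 16 * ((a - m) * (3 / 8))) ≤ (2 * (a : ℝ)) ^ m * (2 * a / 8) := by
    linarith
  have h3 := le_of_mul_le_mul_left h2 hpow
  linarith

/-! ### Privacy contradicts a jump -/

/-- Privacy for two samples that agree outside one place. They may be equal there, and `δ` may be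
negative, hence `max δ 0`. -/
theorem IsDifferentiallyPrivate.apply_le {A : LearningAlgorithm X m} {ε δ : ℝ}
    (hA : IsDifferentiallyPrivate ε δ A) (hε : 0 ≤ ε) {S S' : Fin m → X × Bool} (i : Fin m)
    (h : ∀ j, j ≠ i → S j = S' j) {E : Set (X → Bool)} (hE : MeasurableSet E) :
    (A S E : ℝ) ≤ Real.exp ε * A S' E + max δ 0 := by
  by_cases hi : S i = S' i
  · have : S = S' := funext fun j => by
      by_cases hj : j = i
      · rw [hj, hi]
      · exact h j hj
    rw [this]
    have h1 : (1 : ℝ) ≤ Real.exp ε := Real.one_le_exp hε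
    have h2 : (0 : ℝ) ≤ A S' E := NNReal.coe_nonneg _
    have h3 := le_max_right δ 0
    nlinarith
  · have := (hA S S' ⟨i, hi, fun j hj => by_contra fun hji => hj (h j hji)⟩ E hE).1
    linarith [le_max_left δ 0]

/-- Indices of a sorted sample with `y` at the place `i`: the other points are at the two ends of
the index range. -/
def spreadIndices (W : ℕ) (i : Fin m) (y : ℕ) (l : Fin m) : ℕ :=
  if l < i then l else if l = i then y else W + l

theorem spreadIndices_of_ne {W : ℕ} {i l : Fin m} (y y' : ℕ) (h : l ≠ i) :
    spreadIndices W i y l = spreadIndices W i y' l := by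
  simp [spreadIndices, h]

theorem spreadIndices_lt {W N : ℕ} {i : Fin m} {y : ℕ} (hyW : y < W) (hN : W + m ≤ N)
    (l : Fin m) : spreadIndices W i y l < N := by
  have := l.2
  unfold spreadIndices
  split_ifs <;> omega

theorem strictMono_spreadIndices {W : ℕ} {i : Fin m} {y : ℕ} (hmy : m ≤ y) (hyW : y < W) :
    StrictMono (spreadIndices W i y) := by
  intro k l hkl
  have := k.2
  have := l.2
  have hkl' : (k : ℕ) < l := hkl
  simp only [spreadIndices, Fin.lt_def, Fin.ext_iff]
  split_ifs <;> omega

/-- If the prediction jumps, moving the sample point at the jump through many positions gives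
samples that differ in one example, hence a large family of indistinguishable distributions in
which the position can be recognized from the predictions at the points in between. -/
theorem IsHomogeneous.false_of_jump {A : LearningAlgorithm X m} {x : ℕ → X} {N : ℕ}
    {p : (Fin m → Fin m) → Fin (m + 1) → Fin (m + 1) → ℝ}
    (hp : IsHomogeneous A x N (1 / (8 * m)) p) (hp0 : ∀ σ κ i, 0 ≤ p σ κ i)
    {δ : ℝ} (hA : IsDifferentiallyPrivate (1 / 10) δ A) {K : ℕ} (hK : 3 ≤ K)
    (hN : 2 * m + 2 * 2 ^ K + 1 ≤ N) (hKδ : K * δ ≤ 1 / 4)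
    (hKm : K * Real.exp (-(K * (1 / (8 * m : ℝ)) ^ 2 / 4)) ≤ 1 / 4)
    {σ : Fin m → Fin m} {κ : Fin (m + 1)} {i : Fin m} (hσ : Function.Bijective σ)
    (hjump : p σ κ i.castSucc + 1 / (2 * m) ≤ p σ κ i.succ) : False := by
  classical
  have hm : (0 : ℝ) < m := by exact_mod_cast i.pos
  set W := m + 2 * 2 ^ K + 1 with hW
  -- The moving point takes odd offsets and the queries even ones, so that they never coincide.
  let S : ℕ → Fin m → X × Bool := fun j =>
    orderedSample x (spreadIndices W i (m + 2 * j + 1)) σ κ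
  have hlow : ∀ j < 2 ^ K, ∀ l < 2 ^ K, l ≤ j →
      trueProb A (S j) (x (m + 2 * l)) ≤ p σ κ i.castSucc + 1 / (8 * m) := by
    intro j hj l hl hlj
    have hs := strictMono_spreadIndices (m := m) (i := i) (W := W) (y := m + 2 * j + 1) (by omega)
      (by omega)
    have hs' := spreadIndices_lt (m := m) (i := i) (W := W) (N := N) (y := m + 2 * j + 1) (by omega)
      (by omega)
    -- The query point `m + 2 l` lies to the left of `m + 2 j + 1`, so it has rank `i`.
    have he : StrictMono (i.castSucc.insertNth (m + 2 * l)
        (spreadIndices W i (m + 2 * j + 1)) : Fin (m + 1) → ℕ) := by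
      refine (Fin.strictMono_insertNth_iff _ _ _).mpr ⟨hs, fun k hk => ?_, fun k hk => ?_⟩
      · rw [Fin.castSucc_lt_castSucc_iff] at hk
        have := k.2
        rw [spreadIndices, if_pos hk]
        omega
      · rw [Fin.castSucc_le_castSucc_iff] at hk
        rw [spreadIndices, if_neg hk.not_gt]
        split_ifs <;> omega
    have h := (hp σ κ i.castSucc _ he (fun k => by
      rcases Fin.eq_self_or_eq_succAbove i.castSucc k with rfl | ⟨k, rfl⟩
      · simp only [Fin.insertNth_apply_same]; omega
      · simp only [Fin.insertNth_apply_succAbove]; exact hs' k)).2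
    have hcomp : (i.castSucc.insertNth (m + 2 * l)
        (spreadIndices W i (m + 2 * j + 1)) : Fin (m + 1) → ℕ) ∘ i.castSucc.succAbove =
        spreadIndices W i (m + 2 * j + 1) := by
      funext k; simp
    rw [hcomp, Fin.insertNth_apply_same] at h
    exact h
  have hhigh : ∀ j < 2 ^ K, ∀ l < 2 ^ K, j < l →
      p σ κ i.succ ≤ trueProb A (S j) (x (m + 2 * l)) := by
    intro j hj l hl hlj
    have hs := strictMono_spreadIndices (m := m) (i := i) (W := W) (y := m + 2 * j + 1) (by omega)
      (by omega)
    have hs' := spreadIndices_lt (m := m) (i := i) (W := W) (N := N) (y := m + 2 * j + 1) (by omega)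
      (by omega)
    -- The query point lies to the right of the moving point, so it has rank `i + 1`.
    have he : StrictMono (i.succ.insertNth (m + 2 * l)
        (spreadIndices W i (m + 2 * j + 1)) : Fin (m + 1) → ℕ) := by
      refine (Fin.strictMono_insertNth_iff _ _ _).mpr ⟨hs, fun k hk => ?_, fun k hk => ?_⟩
      · rw [Fin.castSucc_lt_succ_iff] at hk
        have := k.2
        simp only [spreadIndices]
        split_ifs with h1 h2
        · omega
        · omega
        · exact absurd (lt_of_le_of_ne hk h2) h1
      · rw [Fin.succ_le_castSucc_iff] at hk
        rw [spreadIndices, if_neg hk.not_gt, if_neg hk.ne']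
        omega
    have h := (hp σ κ i.succ _ he (fun k => by
      rcases Fin.eq_self_or_eq_succAbove i.succ k with rfl | ⟨k, rfl⟩
      · simp only [Fin.insertNth_apply_same]; omega
      · simp only [Fin.insertNth_apply_succAbove]; exact hs' k)).1
    have hcomp : (i.succ.insertNth (m + 2 * l)
        (spreadIndices W i (m + 2 * j + 1)) : Fin (m + 1) → ℕ) ∘ i.succ.succAbove =
        spreadIndices W i (m + 2 * j + 1) := by
      funext k; simp
    rw [hcomp, Fin.insertNth_apply_same] at h
    exact h
  -- The distributions are restricted to the query points.
  let φ : (X → Bool) → Fin (2 ^ K) → Bool := fun h l => h (x (m + 2 * l))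
  let w : ℕ → (Fin (2 ^ K) → Bool) → ℝ := fun j v => A (S j) {h | φ h ∈ ({v} : Set _)}
  have hφ : Measurable φ := measurable_pi_lambda _ fun l => measurable_pi_apply _
  have hw : ∀ j (E : Finset (Fin (2 ^ K) → Bool)),
      ∑ v ∈ E, w j v = (A (S j) {h | φ h ∈ (E : Set _)} : ℝ) := by
    intro j E
    have h1 : ∀ E : Set (Fin (2 ^ K) → Bool), (A (S j) {h | φ h ∈ E} : ℝ) =
        ((A (S j) : MeasureTheory.Measure (X → Bool)).map φ).real E := fun E =>
      (MeasureTheory.map_measureReal_apply hφ E.toFinite.measurableSet).symm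
    have : MeasureTheory.IsProbabilityMeasure
        ((A (S j) : MeasureTheory.Measure (X → Bool)).map φ) :=
      MeasureTheory.Measure.isProbabilityMeasure_map hφ.aemeasurable
    simp only [w, h1]
    exact MeasureTheory.sum_measureReal_singleton E
  have hB : ∀ j l (hl : l < 2 ^ K), ∑ v, (if v ⟨l, hl⟩ then w j v else 0) =
      trueProb A (S j) (x (m + 2 * l)) := by
    intro j l hl
    rw [← Finset.sum_filter, hw]
    simp [trueProb, φ]
  have hδ0 : K * max δ 0 ≤ 1 / 4 := by
    rcases max_cases δ 0 with ⟨h, -⟩ | ⟨h, -⟩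
    · rwa [h]
    · rw [h]; norm_num
  have hi1 : p σ κ i.succ ≤ 1 := by
    have h1 : 1 < 2 ^ K := Nat.one_lt_two_pow (by omega)
    exact (hhigh 0 (by omega) 1 h1 zero_lt_one).trans (trueProb_le_one _ _ _)
  have hi0 := hp0 σ κ i.castSucc
  have e1 : (1 : ℝ) / (4 * m) = 2 * (1 / (8 * m)) := by field_simp; norm_num
  have e2 : (1 : ℝ) / (2 * m) = 4 * (1 / (8 * m)) := by field_simp; norm_num
  have e3 : (0 : ℝ) < 1 / (8 * m) := by positivity
  -- The threshold `r` leaves a margin of `1 / (8 m)` above the rounding error `1 / (8 m)` of the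
  -- values before the jump, and a larger one below the values after it.
  refine no_large_threshold_family hK (γ := 1 / (8 * m)) (δ := max δ 0)
    (r := p σ κ i.castSucc + 1 / (4 * m)) e3 (by linarith) (by linarith) (le_max_right _ _) hδ0 hKm
    w (fun j v => NNReal.coe_nonneg _) (fun j => by rw [hw]; simp) (fun j _ E => ?_)
    (fun l v => if h : l < 2 ^ K then v ⟨l, h⟩ else false) (fun j hj l hl hlj => ?_)
    (fun j hj l hl hlj => ?_)
  · simp only [hw]
    obtain ⟨k, hk⟩ := hσ.2 i
    refine hA.apply_le (by norm_num) k (fun k' hk' => ?_)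
      (hφ (E : Set (Fin (2 ^ K) → Bool)).toFinite.measurableSet)
    simp only [S, orderedSample]
    rw [spreadIndices_of_ne]
    exact fun h => hk' (hσ.1 (h.trans hk.symm))
  · simp only [hl, dif_pos, hB]
    have := hlow j hj l hl hlj
    linarith
  · simp only [hl, dif_pos, hB]
    have := hhigh j hj l hl hlj
    linarith

/-! ### The lower bound -/

theorem one_le_logb_two (hm : 2 ≤ m) : 1 ≤ Real.logb 2 m := by
  rw [Real.le_logb_iff_rpow_le (by norm_num) (by positivity), Real.rpow_one]
  exact_mod_cast hm

theorem logb_two_le (hm : 2 ≤ m) : Real.logb 2 m ≤ m := by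
  rw [Real.logb_le_iff_le_rpow (by norm_num) (by positivity), Real.rpow_natCast]
  exact_mod_cast Nat.lt_two_pow_self.le

/-- The number of independent samples used for binary search: of the order `m ^ 2 * log m`, so that
it makes the probability of a wrong answer polynomially small in `m`. -/
theorem exists_sampleCount (hm : 2 ≤ m) {δ : ℝ}
    (hδ : δ ≤ 1 / 40000 / ((m : ℝ) ^ 2 * Real.logb 2 m)) :
    ∃ K : ℕ, 5120 * m ^ 2 ≤ K ∧ K + 2 ≤ 2 ^ (10 * m) ∧ K * δ ≤ 1 / 4 ∧
      K * Real.exp (-(K * (1 / (8 * m : ℝ)) ^ 2 / 4)) ≤ 1 / 4 := by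
  set L := Real.logb 2 m with hL
  have hL1 : 1 ≤ L := one_le_logb_two hm
  have hLm : L ≤ m := logb_two_le hm
  have hm' : (2 : ℝ) ≤ m := by exact_mod_cast hm
  have hm2 : (4 : ℝ) ≤ (m : ℝ) ^ 2 := by nlinarith
  have hmL : (4 : ℝ) ≤ (m : ℝ) ^ 2 * L := by nlinarith
  set K := ⌈5120 * ((m : ℝ) ^ 2 * L)⌉₊ with hK
  have hK1 : 5120 * ((m : ℝ) ^ 2 * L) ≤ K := Nat.le_ceil _
  have hK2 : (K : ℝ) ≤ 5121 * ((m : ℝ) ^ 2 * L) := by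
    have := Nat.ceil_lt_add_one (a := 5120 * ((m : ℝ) ^ 2 * L)) (by positivity)
    linarith
  have hK3 : (K : ℝ) ≤ 5121 * (m : ℝ) ^ 3 := by
    refine hK2.trans ?_
    rw [pow_succ (m : ℝ) 2]
    gcongr
  refine ⟨K, ?_, ?_, ?_, ?_⟩
  · have : (5120 * m ^ 2 : ℝ) ≤ K := by nlinarith
    exact_mod_cast this
  · have h1 : K ≤ 5121 * m ^ 3 := by exact_mod_cast hK3
    have h2 : m ^ 3 ≤ (2 ^ m) ^ 3 := Nat.pow_le_pow_left Nat.lt_two_pow_self.le 3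
    have h3 : 0 < (2 ^ m) ^ 3 := by positivity
    calc K + 2 ≤ 2 ^ 13 * (2 ^ m) ^ 3 := by omega
      _ = 2 ^ (13 + m * 3) := by rw [pow_add, pow_mul]
      _ ≤ 2 ^ (10 * m) := Nat.pow_le_pow_right (by norm_num) (by omega)
  -- `5121 / 40000 ≤ 1 / 4`; this is what fixes the constant in the bound on `δ`.
  · rcases le_or_gt δ 0 with h0 | h0
    · have := mul_nonpos_of_nonneg_of_nonpos (Nat.cast_nonneg (α := ℝ) K) h0
      linarith
    · rw [le_div_iff₀ (by positivity)] at hδ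
      have := mul_le_mul_of_nonneg_right hK2 h0.le
      linarith
  · have hlog : Real.log m ≤ L := by
      rw [hL, Real.logb, le_div_iff₀ (Real.log_pos (by norm_num))]
      refine mul_le_of_le_one_right (Real.log_nonneg (by linarith)) ?_
      linarith [Real.log_two_lt_d9]
    -- `5120 = 20 * 256`, so that the exponential is at most `m ^ (-20)`.
    have h1 : 20 * Real.log m ≤ K * (1 / (8 * m : ℝ)) ^ 2 / 4 := by
      have h2 : (K : ℝ) * (1 / (8 * m : ℝ)) ^ 2 / 4 = K / (256 * (m : ℝ) ^ 2) := by
        field_simp; ring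
      rw [h2, le_div_iff₀ (by positivity)]
      nlinarith
    have h2 : Real.exp (-(K * (1 / (8 * m : ℝ)) ^ 2 / 4)) ≤ ((m : ℝ) ^ 20)⁻¹ := by
      rw [Real.exp_neg]
      refine inv_anti₀ (by positivity) ?_
      calc (m : ℝ) ^ 20 = Real.exp ((20 : ℕ) * Real.log m) := by
            rw [Real.exp_nat_mul, Real.exp_log (by linarith)]
        _ ≤ _ := Real.exp_le_exp.mpr (by exact_mod_cast h1)
    refine (mul_le_mul hK3 h2 (Real.exp_nonneg _) (by positivity)).trans ?_
    rw [← div_eq_mul_inv, div_le_div_iff₀ (by positivity) (by norm_num), one_mul]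
    have h3 : (2 : ℝ) ^ 17 ≤ (m : ℝ) ^ 17 := pow_le_pow_left₀ (by norm_num) hm' 17
    rw [show (m : ℝ) ^ 20 = (m : ℝ) ^ 17 * (m : ℝ) ^ 3 by ring]
    have h4 : (0 : ℝ) ≤ (m : ℝ) ^ 3 := by positivity
    nlinarith

/-- A bound for the number of colours: the values `⌊8 m · probability⌋` for all arrangements, numbers
of negative labels and ranks. -/
theorem card_colours_le (m : ℕ) :
    (8 * m + 1) ^ (m ^ m * (m + 1) * (m + 1)) ≤ 2 ^ 2 ^ (m * m + 3 * m + 3) := by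
  have h1 : 8 * m + 1 ≤ 2 ^ (8 * m) := Nat.lt_two_pow_self
  refine (Nat.pow_le_pow_left h1 _).trans ?_
  rw [← pow_mul]
  refine Nat.pow_le_pow_right (by norm_num) ?_
  have h2 : m + 1 ≤ 2 ^ m := Nat.lt_two_pow_self
  have h3 : m ^ m ≤ 2 ^ (m * m) := by
    rw [pow_mul]; exact Nat.pow_le_pow_left Nat.lt_two_pow_self.le _
  calc 8 * m * (m ^ m * (m + 1) * (m + 1))
      ≤ 2 ^ 3 * 2 ^ m * (2 ^ (m * m) * 2 ^ m * 2 ^ m) := by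
        gcongr
        · norm_num
        · omega
    _ = 2 ^ (m * m + 3 * m + 3) := by simp only [← pow_add]; congr 1; ring

/-- The number of thresholds that rule out a learner with `m` examples has an iterated logarithm of
order `m`. -/
theorem logStar_ramseyBound_le (hm : 2 ≤ m) {K : ℕ} (hK : K + 2 ≤ 2 ^ (10 * m)) :
    logStar (ramseyBound (2 ^ 2 ^ (m * m + 3 * m + 3)) (2 ^ (K + 2)) (m + 1) : ℕ) ≤
      13 * m + 4 := by
  set L := m * m + 3 * m + 3
  have h1 := ramseyBound_le (q := 2 ^ 2 ^ L) (N := 2 ^ (K + 2)) le_rfl (m + 1)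
  have h2 : 2 ^ (K + 2) + (L + 2) ≤ 2 ^ 2 ^ (11 * m) := by
    have h3 : 2 ^ (K + 2) ≤ 2 ^ 2 ^ (10 * m) := Nat.pow_le_pow_right (by norm_num) hK
    have h4 : L + 2 ≤ 2 ^ 2 ^ (10 * m) := by
      have h5 : m * m ≤ 2 ^ m * 2 ^ m := Nat.mul_self_le_mul_self Nat.lt_two_pow_self.le
      calc L + 2 ≤ 2 ^ 3 * (2 ^ m * 2 ^ m) := by simp only [L]; nlinarith
        _ = 2 ^ (3 + (m + m)) := by simp only [← pow_add]
        _ ≤ 2 ^ (10 * m) := Nat.pow_le_pow_right (by norm_num) (by omega)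
        _ ≤ 2 ^ 2 ^ (10 * m) := Nat.lt_two_pow_self.le
    have h5 : 2 ^ 2 ^ (10 * m) * 2 ≤ 2 ^ 2 ^ (11 * m) := by
      rw [← pow_succ]
      exact Nat.pow_le_pow_right (by norm_num) (Nat.pow_lt_pow_right (by norm_num) (by omega))
    omega
  have h3 := logStar_iterate_le (m + 1) (2 ^ (K + 2) + (L + 2))
  have h4 : logStar ((2 ^ (K + 2) + (L + 2) : ℕ) : ℝ) ≤ 2 + 11 * m := by
    refine (logStar_mono (Nat.cast_le.mpr h2)).trans ?_
    have := logStar_two_pow_le (2 ^ (11 * m))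
    have := logStar_two_pow_le (11 * m)
    have := logStar_natCast_le (11 * m)
    push_cast at *
    omega
  have h5 := logStar_mono (Nat.cast_le (α := ℝ).mpr ((Nat.le_add_right _ (L + 2)).trans h1))
  omega

/-- The case of at least two examples: a class of large Littlestone dimension has many thresholds, a
homogeneous set among them, and there accuracy and privacy contradict each other. -/
theorem littlestoneDim_lt_of_private_learner (hm : 2 ≤ m) {H : Set (X → Bool)} {δ : ℝ}
    {A : LearningAlgorithm X m} (hδ : δ ≤ 1 / 40000 / ((m : ℝ) ^ 2 * Real.logb 2 m))
    (hA : IsAccurate H (1 / 16) (1 / 16) A) (hp : IsDifferentiallyPrivate (1 / 10) δ A) :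
    ∃ n : ℕ, littlestoneDim H < (2 ^ n : ℕ) ∧ logStar (n : ℝ) ≤ 13 * m + 4 := by
  obtain ⟨K, hK1, hK2, hKδ, hKm⟩ := exists_sampleCount hm hδ
  refine ⟨_, ?_, logStar_ramseyBound_le hm hK2⟩
  by_contra! hd
  have hpos : 0 < ramseyBound (2 ^ 2 ^ (m * m + 3 * m + 3)) (2 ^ (K + 2)) (m + 1) := by
    simp only [ramseyBound]; positivity
  obtain ⟨x, g, hx⟩ :=
    (shattersIn_of_le_littlestoneDim (by positivity) hd).exists_isThresholds hpos
  have hm0 : 0 < m := by omega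
  obtain ⟨x', g', hx', p, hp0, hhom⟩ := hx.exists_isHomogeneous A (R := 8 * m) (by omega)
    (q := 2 ^ 2 ^ (m * m + 3 * m + 3)) (Nat.le_self_pow (by positivity) 2)
    (card_colours_le m) le_rfl
  push_cast at hhom
  -- A homogeneous set of `4 * 2 ^ K` points is large enough for both halves of the argument.
  have hKlt : K < 2 ^ K := Nat.lt_two_pow_self
  have hmm : m ≤ m ^ 2 := Nat.le_self_pow (by norm_num) m
  have hN : 2 ^ (K + 2) = 4 * 2 ^ K := by ring
  obtain ⟨σ, κ, i, hσ, hjump⟩ := exists_jump hm0 hA hx' hhom (by omega)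
  exact hhom.false_of_jump hp0 hp (by nlinarith) (by omega) hKδ hKm hσ hjump

theorem logStar_littlestoneDim_le {H : Set (X → Bool)} {δ : ℝ} {A : LearningAlgorithm X m}
    (hδ : 2 ≤ m → δ ≤ 1 / 40000 / ((m : ℝ) ^ 2 * Real.logb 2 m))
    (hA : IsAccurate H (1 / 16) (1 / 16) A) (hp : IsDifferentiallyPrivate (1 / 10) δ A) :
    ∃ d : ℕ, littlestoneDim H = d ∧ logStar (d : ℝ) ≤ 16 * m := by
  rcases lt_or_ge m 2 with hm | hm
  · have hlt : littlestoneDim H < (2 : ℕ) := by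
      by_contra! h
      have := hA.two_lt (shattersIn_of_le_littlestoneDim (by norm_num) h)
      omega
    obtain ⟨d, hd⟩ := ENat.ne_top_iff_exists.mp hlt.ne_top
    rw [← hd, Nat.cast_lt] at hlt
    refine ⟨d, hd.symm, ?_⟩
    rw [logStar_of_le_one (by exact_mod_cast Nat.lt_succ_iff.mp hlt)]
    exact Nat.zero_le _
  · obtain ⟨n, hlt, hn⟩ := littlestoneDim_lt_of_private_learner hm (hδ hm) hA hp
    obtain ⟨d, hd⟩ := ENat.ne_top_iff_exists.mp hlt.ne_top
    rw [← hd, Nat.cast_lt] at hlt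
    refine ⟨d, hd.symm, ?_⟩
    have h1 : logStar (d : ℝ) ≤ logStar ((2 : ℝ) ^ n) := logStar_mono (by exact_mod_cast hlt.le)
    have h2 := logStar_two_pow_le n
    omega

theorem IsDifferentiallyPrivate.mono {A : LearningAlgorithm X m} {ε ε' δ : ℝ} (hε : ε ≤ ε')
    (hA : IsDifferentiallyPrivate ε δ A) : IsDifferentiallyPrivate ε' δ A := by
  intro S S' h E hE
  have h1 := hA S S' h E hE
  have h2 : Real.exp ε ≤ Real.exp ε' := Real.exp_le_exp.mpr hε
  constructor
  · refine h1.1.trans ?_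
    gcongr
  · refine h1.2.trans ?_
    gcongr

theorem PrivatelyLearnable.littlestoneDim_lt_top {H : Set (X → Bool)}
    (hH : PrivatelyLearnable H) : littlestoneDim H < ⊤ := by
  obtain ⟨A, ε, δ, hε, hδ, hp, hA⟩ := hH
  obtain ⟨m₀, hm₀⟩ := hA (1 / 16) (1 / 16) (by norm_num) (by norm_num)
  -- Superpolynomial decay gives `δ m ≤ c / m ^ 3`, which is below `c / (m ^ 2 * log m)`.
  obtain ⟨m, hm1, hm2, hm3, hm4⟩ := ((Filter.eventually_ge_atTop m₀).and
    ((Filter.eventually_ge_atTop 2).and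
      ((hε.eventually_le_const (by norm_num : (0 : ℝ) < 1 / 10)).and
        ((hδ 3).eventually_le_const (by norm_num : (0 : ℝ) < 1 / 40000))))).exists
  have hL := one_le_logb_two hm2
  have hLm := logb_two_le hm2
  have hm : (0 : ℝ) < m := by positivity
  have hδm : δ m ≤ 1 / 40000 / ((m : ℝ) ^ 2 * Real.logb 2 m) := by
    rw [mul_comm, ← le_div_iff₀ (by positivity)] at hm4
    refine hm4.trans ?_
    rw [pow_succ (m : ℝ) 2]
    gcongr
  obtain ⟨d, hd, -⟩ := logStar_littlestoneDim_le (fun _ => hδm) (hm₀ m hm1) ((hp m).mono hm3)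
  rw [hd]
  exact ENat.natCast_lt_top d

end PrivateLearning

theorem corollary2 :
    (∃ (c : ℝ) (C : ℝ≥0), 0 < c ∧ 0 < C ∧
      ∀ (X : Type u) (H : Set (X → Bool)) (d : ℕ∞), littlestoneDim H = d →
      ∀ (m : ℕ) (δ : ℝ) (A : LearningAlgorithm X m),
        -- `δ ≤ c / (m² log m)`, where the right-hand side is `∞` for `m ≤ 1`
        (2 ≤ m → δ ≤ c / ((m : ℝ) ^ 2 * Real.logb 2 m)) →
        IsAccurate H (1 / 16) (1 / 16) A →
        IsDifferentiallyPrivate (1 / 10) δ A →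
        (C : ℝ≥0∞) * (logStarENat d : ℝ≥0∞) ≤ (m : ℝ≥0∞)) ∧
    (∀ (X : Type u) (H : Set (X → Bool)), PrivatelyLearnable H → littlestoneDim H < ⊤) := by
  refine ⟨⟨1 / 40000, 1 / 16, by norm_num, by norm_num, ?_⟩, fun X H h => h.littlestoneDim_lt_top⟩
  intro X H d hd m δ A hδ hA hp
  obtain ⟨k, hk, hle⟩ := logStar_littlestoneDim_le hδ hA hp
  rw [← hd, hk]
  change ((1 / 16 : ℝ≥0) : ℝ≥0∞) * (((logStar (k : ℝ) : ℕ) : ℕ∞) : ℝ≥0∞) ≤ m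
  rw [ENat.toENNReal_coe]
  have h1 : (1 / 16 : ℝ≥0) * (logStar (k : ℝ) : ℝ≥0) ≤ (m : ℝ≥0) := by
    have h2 : (logStar (k : ℝ) : ℝ≥0) ≤ 16 * (m : ℝ≥0) := by exact_mod_cast hle
    rw [one_div, inv_mul_le_iff₀ (by norm_num)]
    exact h2
  exact_mod_cast h1
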